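/- **Definitions.** For a set $X$, $\mathbb N[X]$ is the underlying set of the free commutative monoid on $X$ (finite multisets in $X$), and $\mathbb N[f]\colon\mathbb N[X]\to\mathbb N[Y]$ is the map induced by a function $f\colon X\to Y$. A *Petri net* $P$ is a pair of functions $s,t\colon T\to\mathbb N[S]$ from a set $T$ of transitions to the multisets in a set $S$ of places. A morphism from $(s,t\colon T\to\mathbb N[S])$ to $(s',t'\colon T'\to\mathbb N[S'])$ is a pair of functions $f\colon T\to T'$, $g\colon S\to S'$ with $\mathbb N[g]\circ s=s'\circ f$ and $\mathbb N[g]\circ t=t'\circ f$. This gives a category $\mathsf{Petri}$. The functor $L\colon\mathsf{Set}\to\mathsf{Petri}$, left adjoint to the functor taking a Petri net to its set of places, sends $X$ to the net with set of places $X$ and no transitions. A *marking* of $P$ is an element of $\mathbb N[S]$. A *firing* of $\tau\in T$ is a triple $(\tau,m,n)$ of $\tau$ and markings $m,n$ with $s(\tau)\le m$ and $n=m-s(\tau)+t(\tau)$. A marking $n$ is *reachable* from $m$ if a finite, possibly empty, sequence of firings leads from $m$ to $n$. An *open Petri net* $P\colon X\nrightarrow Y$ is a cospan $LX\xrightarrow{\,i\,}P\xleftarrow{\,o\,}LY$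 in $\mathsf{Petri}$. Its *reachability relation* is $$\blacksquare P=\{(x,y)\in\mathbb N[X]\times\mathbb N[Y]\mid \mathbb N[o](y)\text{ is reachable from }\mathbb N[i](x)\text{ in }P\}.$$ $\mathbb{O}\mathbf{pen}(\mathsf{Petri})$ is the symmetric monoidal double category whose objects are sets, whose vertical 1-morphisms are functions, whose horizontal 1-cells $X\nrightarrow Y$ are open Petri nets, with composition $Q\odot P$ given by pushout, and whose 2-morphisms from $LX\xrightarrow{i}P\xleftarrow{o}LY$ to $LX'\xrightarrow{i'}P'\xleftarrow{o'}LY'$ are triples of $f\colon X\to X'$, $\alpha\colon P\to P'$, $g\colon Y\to Y'$ with $\alpha i=i'\circ Lf$ and $\alpha o=o'\circ Lg$. Its tensor product is $X+Y$ on sets and $LX+LX'\cong L(X+X')\to P+P'\leftarrow L(Y+Y')\cong LY+LY'$ on open Petri nets, given by coproducts. $\mathbb R\mathbf{el}$ is the symmetric monoidal double category whose objects are sets, whose vertical 1-morphisms are functions, whose horizontal 1-cells $X\nrightarrow Y$ are relations $R\subseteq X\times Y$ with the usual composition, and where there is exactly one 2-morphism from $R\subseteq X\times Y$ to $S\subseteq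 X'\times Y'$ with vertical sides $f\colon X\to X'$, $g\colon Y\to Y'$ if $(f\times g)R\subseteq S$, and none otherwise. Its tensor product is the cartesian product of sets and of relations. A *lax double functor* $F\colon\mathbb C\to\mathbb D$ consists of functors $F_0$, $F_1$ between the categories of objects and between the categories of arrows (horizontal 1-cells and 2-morphisms), with $S\circ F_1=F_0\circ S$ and $T\circ F_1=F_0\circ T$ for the source and target functors $S,T$, together with natural composition comparisons $F(N)\odot F(M)\Rightarrow F(N\odot M)$ and identity comparisons $U_{F(X)}\Rightarrow F(U_X)$ that $S$ and $T$ send to identities, compatible with the associators and the left and right unitors. It is *symmetric monoidal* when $F_0$ and $F_1$ are equipped with the structure of (strong) symmetric monoidal functors such that $S\circ F_1=F_0\circ S$ and $T\circ F_1=F_0\circ T$ are equations of monoidal functors and the composition and identity comparisons are monoidal natural transformations. **Theorem.** The reachability semantics $\blacksquare\colon\mathbb{O}\mathbf{pen}(\mathsf{Petri})\to\mathbb R\mathbf{el}$, which sends a set $X$ to $\mathbb N[X]$, a function $f$ to $\mathbb N[f]$, an open Petri net $P\colon X\nrightarrow Y$ to its reachability relation $\blacksquare P$, and a 2-morphism $(f,\alpha,g)$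 from $P$ to $P'$ to the square with vertical sides $\mathbb N[f]$ and $\mathbb N[g]$ (expressing that $(\mathbb N[f]\times\mathbb N[g])\,\blacksquare P\subseteq\blacksquare P'$), is a lax double functor, and it is symmetric monoidal. The symmetric monoidal structure can be chosen so that the structure map of $F_0$ is the bijection $\mathbb N[X]\times\mathbb N[Y]\cong\mathbb N[X+Y]$, $(x,y)\mapsto\mathbb N[\mathrm{inl}](x)+\mathbb N[\mathrm{inr}](y)$, where $\mathrm{inl},\mathrm{inr}$ are the coprojections of $X+Y$; and under these bijections the reachability relation of the disjoint union is the product of the reachability relations: for all $P\colon X\nrightarrow Y$, $P'\colon X'\nrightarrow Y'$, $x\in\mathbb N[X]$, $x'\in\mathbb N[X']$, $y\in\mathbb N[Y]$, $y'\in\mathbb N[Y']$, $$\bigl(\mathbb N[\mathrm{inl}](x)+\mathbb N[\mathrm{inr}](x'),\ \mathbb N[\mathrm{inl}](y)+\mathbb N[\mathrm{inr}](y')\bigr)\in\blacksquare(P+P')\iff(x,y)\in\blacksquare P\text{ and }(x',y')\in\blacksquare P'.$$ -/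

import Mathlib

open CategoryTheory MonoidalCategory

universe u v w z u₀ v₀ w₀ z₀

/-! ## Double categories -/

/-- A horizontal 1-cell together with its source and target: an object of the category of arrows. -/
structure HCell {Obj : Type u} (Hor : Obj → Obj → Type w) where
  src : Obj
  tgt : Obj
  cell : Hor src tgt

/-- A (pseudo) double category.  `Obj` is the category of objects (vertical 1-morphisms are its
morphisms) and `HCell Hor` is the category of arrows: its objects are the horizontal 1-cells,
its morphisms are the 2-morphisms.  The source and target functors are the projections
`HCell.src`, `HCell.tgt` on objects, and `srcMap`, `tgtMap` on morphisms.  Horizontal composition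
is written in the order `comp N M = N ⊙ M` for `M : A ⇸ B` and `N : B ⇸ C`, and a pair of
2-morphisms in the pullback of the target functor along the source functor is a pair `β`, `α` with
`srcMap β = tgtMap α`. -/
structure DoubleCategory where
  Obj : Type u₀
  [catObj : Category.{v₀} Obj]
  Hor : Obj → Obj → Type w₀
  [catArr : Category.{z₀} (HCell Hor)]
  -- source and target functors
  srcMap {M N : HCell Hor} : (M ⟶ N) → (M.src ⟶ N.src)
  tgtMap {M N : HCell Hor} : (M ⟶ N) → (M.tgt ⟶ N.tgt)
  srcMap_id (M : HCell Hor) : srcMap (𝟙 M) = 𝟙 M.src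
  tgtMap_id (M : HCell Hor) : tgtMap (𝟙 M) = 𝟙 M.tgt
  srcMap_comp {M N K : HCell Hor} (α : M ⟶ N) (β : N ⟶ K) :
    srcMap (α ≫ β) = srcMap α ≫ srcMap β
  tgtMap_comp {M N K : HCell Hor} (α : M ⟶ N) (β : N ⟶ K) :
    tgtMap (α ≫ β) = tgtMap α ≫ tgtMap β
  -- identity-assigning functor
  unit (A : Obj) : Hor A A
  unitMap {A B : Obj} (f : A ⟶ B) : HCell.mk A A (unit A) ⟶ HCell.mk B B (unit B)
  srcMap_unitMap {A B : Obj} (f : A ⟶ B) : srcMap (unitMap f) = f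
  tgtMap_unitMap {A B : Obj} (f : A ⟶ B) : tgtMap (unitMap f) = f
  unitMap_id (A : Obj) : unitMap (𝟙 A) = 𝟙 _
  unitMap_comp {A B C : Obj} (f : A ⟶ B) (g : B ⟶ C) : unitMap (f ≫ g) = unitMap f ≫ unitMap g
  -- composition functor
  comp {A B C : Obj} (N : Hor B C) (M : Hor A B) : Hor A C
  compMap {A B C A' B' C' : Obj} {N : Hor B C} {M : Hor A B} {N' : Hor B' C'} {M' : Hor A' B'}
    (β : HCell.mk B C N ⟶ HCell.mk B' C' N') (α : HCell.mk A B M ⟶ HCell.mk A' B' M')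
    (h : srcMap β = tgtMap α) : HCell.mk A C (comp N M) ⟶ HCell.mk A' C' (comp N' M')
  srcMap_compMap {A B C A' B' C' : Obj} {N : Hor B C} {M : Hor A B} {N' : Hor B' C'}
    {M' : Hor A' B'} (β : HCell.mk B C N ⟶ HCell.mk B' C' N')
    (α : HCell.mk A B M ⟶ HCell.mk A' B' M') (h : srcMap β = tgtMap α) :
    srcMap (compMap β α h) = srcMap α
  tgtMap_compMap {A B C A' B' C' : Obj} {N : Hor B C} {M : Hor A B} {N' : Hor B' C'}
    {M' : Hor A' B'} (β : HCell.mk B C N ⟶ HCell.mk B' C' N')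
    (α : HCell.mk A B M ⟶ HCell.mk A' B' M') (h : srcMap β = tgtMap α) :
    tgtMap (compMap β α h) = tgtMap β
  compMap_id {A B C : Obj} (N : Hor B C) (M : Hor A B) :
    compMap (𝟙 (HCell.mk B C N)) (𝟙 (HCell.mk A B M))
      ((srcMap_id ⟨_, _, N⟩).trans (tgtMap_id ⟨_, _, M⟩).symm) = 𝟙 _
  compMap_comp {A B C A' B' C' A'' B'' C'' : Obj} {N : Hor B C} {M : Hor A B} {N' : Hor B' C'}
    {M' : Hor A' B'} {N'' : Hor B'' C''} {M'' : Hor A'' B''}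
    (β : HCell.mk B C N ⟶ HCell.mk B' C' N') (α : HCell.mk A B M ⟶ HCell.mk A' B' M')
    (β' : HCell.mk B' C' N' ⟶ HCell.mk B'' C'' N'') (α' : HCell.mk A' B' M' ⟶ HCell.mk A'' B'' M'')
    (h : srcMap β = tgtMap α) (h' : srcMap β' = tgtMap α') :
    compMap (β ≫ β') (α ≫ α') (by rw [srcMap_comp, tgtMap_comp, h, h']) =
      compMap β α h ≫ compMap β' α' h'
  -- associator
  assoc {A B C D : Obj} (N : Hor C D) (N' : Hor B C) (N'' : Hor A B) :
    HCell.mk A D (comp (comp N N') N'') ≅ HCell.mk A D (comp N (comp N' N''))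
  srcMap_assoc {A B C D : Obj} (N : Hor C D) (N' : Hor B C) (N'' : Hor A B) :
    srcMap (assoc N N' N'').hom = 𝟙 A
  tgtMap_assoc {A B C D : Obj} (N : Hor C D) (N' : Hor B C) (N'' : Hor A B) :
    tgtMap (assoc N N' N'').hom = 𝟙 D
  assoc_naturality {A B C D A' B' C' D' : Obj} {N : Hor C D} {N' : Hor B C} {N'' : Hor A B}
    {K : Hor C' D'} {K' : Hor B' C'} {K'' : Hor A' B'} (γ : HCell.mk C D N ⟶ HCell.mk C' D' K)
    (β : HCell.mk B C N' ⟶ HCell.mk B' C' K') (α : HCell.mk A B N'' ⟶ HCell.mk A' B' K'')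
    (h : srcMap γ = tgtMap β) (h' : srcMap β = tgtMap α) :
    compMap (compMap γ β h) α ((srcMap_compMap γ β h).trans h') ≫ (assoc K K' K'').hom =
      (assoc N N' N'').hom ≫ compMap γ (compMap β α h') (h.trans (tgtMap_compMap β α h').symm)
  -- left unitor
  leftUnitor {A B : Obj} (N : Hor A B) : HCell.mk A B (comp (unit B) N) ≅ HCell.mk A B N
  srcMap_leftUnitor {A B : Obj} (N : Hor A B) : srcMap (leftUnitor N).hom = 𝟙 A
  tgtMap_leftUnitor {A B : Obj} (N : Hor A B) : tgtMap (leftUnitor N).hom = 𝟙 B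
  leftUnitor_naturality {A B A' B' : Obj} {N : Hor A B} {N' : Hor A' B'}
    (α : HCell.mk A B N ⟶ HCell.mk A' B' N') :
    compMap (unitMap (tgtMap α)) α (srcMap_unitMap _) ≫ (leftUnitor N').hom =
      (leftUnitor N).hom ≫ α
  -- right unitor
  rightUnitor {A B : Obj} (N : Hor A B) : HCell.mk A B (comp N (unit A)) ≅ HCell.mk A B N
  srcMap_rightUnitor {A B : Obj} (N : Hor A B) : srcMap (rightUnitor N).hom = 𝟙 A
  tgtMap_rightUnitor {A B : Obj} (N : Hor A B) : tgtMap (rightUnitor N).hom = 𝟙 B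
  rightUnitor_naturality {A B A' B' : Obj} {N : Hor A B} {N' : Hor A' B'}
    (α : HCell.mk A B N ⟶ HCell.mk A' B' N') :
    compMap α (unitMap (srcMap α)) (tgtMap_unitMap _).symm ≫ (rightUnitor N').hom =
      (rightUnitor N).hom ≫ α
  -- coherence
  pentagon {A B C D E : Obj} (W : Hor D E) (X : Hor C D) (Y : Hor B C) (Z : Hor A B) :
    compMap (assoc W X Y).hom (𝟙 (HCell.mk A B Z)) ((srcMap_assoc W X Y).trans (tgtMap_id ⟨_, _, Z⟩).symm) ≫
        (assoc W (comp X Y) Z).hom ≫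
          compMap (𝟙 (HCell.mk D E W)) (assoc X Y Z).hom
            ((srcMap_id ⟨_, _, W⟩).trans (tgtMap_assoc X Y Z).symm) =
      (assoc (comp W X) Y Z).hom ≫ (assoc W X (comp Y Z)).hom
  triangle {A B C : Obj} (N : Hor B C) (M : Hor A B) :
    (assoc N (unit B) M).hom ≫
        compMap (𝟙 (HCell.mk B C N)) (leftUnitor M).hom
          ((srcMap_id ⟨_, _, N⟩).trans (tgtMap_leftUnitor M).symm) =
      compMap (rightUnitor N).hom (𝟙 (HCell.mk A B M))
        ((srcMap_rightUnitor N).trans (tgtMap_id ⟨_, _, M⟩).symm)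

attribute [instance] DoubleCategory.catObj DoubleCategory.catArr

/-! ## Symmetric monoidal double categories -/

/-- A symmetric monoidal double category.  The category of objects is a symmetric monoidal
category, the category of arrows is a symmetric monoidal category whose unit is the identity cell
of the unit object, the source and target functors are strict symmetric monoidal, the tensor
product is a double functor with comparisons `χ` and `μ`, and the associator, the unitors and the
braiding are transformations between double functors. -/
structure SymmetricMonoidalDoubleCategory extends DoubleCategory.{u₀, v₀, w₀, z₀} where
  [monObj : MonoidalCategory Obj]
  [symmObj : SymmetricCategory Obj]
  -- the tensor product on the category of arrows
  tensor {A B A' B' : Obj} (M : Hor A B) (N : Hor A' B') : Hor (A ⊗ A') (B ⊗ B')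
  tensorMap {M N M' N' : HCell Hor} (α : M ⟶ M') (β : N ⟶ N') :
    HCell.mk (M.src ⊗ N.src) (M.tgt ⊗ N.tgt) (tensor M.cell N.cell) ⟶
      HCell.mk (M'.src ⊗ N'.src) (M'.tgt ⊗ N'.tgt) (tensor M'.cell N'.cell)
  srcMap_tensorMap {M N M' N' : HCell Hor} (α : M ⟶ M') (β : N ⟶ N') :
    srcMap (tensorMap α β) = srcMap α ⊗ₘ srcMap β
  tgtMap_tensorMap {M N M' N' : HCell Hor} (α : M ⟶ M') (β : N ⟶ N') :
    tgtMap (tensorMap α β) = tgtMap α ⊗ₘ tgtMap β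
  tensorMap_id (M N : HCell Hor) : tensorMap (𝟙 M) (𝟙 N) = 𝟙 _
  tensorMap_comp {M N M' N' M'' N'' : HCell Hor} (α : M ⟶ M') (β : N ⟶ N') (α' : M' ⟶ M'')
    (β' : N' ⟶ N'') : tensorMap α β ≫ tensorMap α' β' = tensorMap (α ≫ α') (β ≫ β')
  -- its associator, unitors and braiding
  tensorAssoc {A B A' B' A'' B'' : Obj} (M : Hor A B) (N : Hor A' B') (P : Hor A'' B'') :
    HCell.mk ((A ⊗ A') ⊗ A'') ((B ⊗ B') ⊗ B'') (tensor (tensor M N) P) ≅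
      HCell.mk (A ⊗ (A' ⊗ A'')) (B ⊗ (B' ⊗ B'')) (tensor M (tensor N P))
  srcMap_tensorAssoc {A B A' B' A'' B'' : Obj} (M : Hor A B) (N : Hor A' B') (P : Hor A'' B'') :
    srcMap (tensorAssoc M N P).hom = (α_ A A' A'').hom
  tgtMap_tensorAssoc {A B A' B' A'' B'' : Obj} (M : Hor A B) (N : Hor A' B') (P : Hor A'' B'') :
    tgtMap (tensorAssoc M N P).hom = (α_ B B' B'').hom
  tensorAssoc_naturality {M N P M' N' P' : HCell Hor} (α : M ⟶ M') (β : N ⟶ N') (γ : P ⟶ P') :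
    tensorMap (tensorMap α β) γ ≫ (tensorAssoc M'.cell N'.cell P'.cell).hom =
      (tensorAssoc M.cell N.cell P.cell).hom ≫ tensorMap α (tensorMap β γ)
  tensorLeft {A B : Obj} (M : Hor A B) :
    HCell.mk (𝟙_ Obj ⊗ A) (𝟙_ Obj ⊗ B) (tensor (unit (𝟙_ Obj)) M) ≅ HCell.mk A B M
  srcMap_tensorLeft {A B : Obj} (M : Hor A B) : srcMap (tensorLeft M).hom = (λ_ A).hom
  tgtMap_tensorLeft {A B : Obj} (M : Hor A B) : tgtMap (tensorLeft M).hom = (λ_ B).hom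
  tensorLeft_naturality {M M' : HCell Hor} (α : M ⟶ M') :
    tensorMap (𝟙 (HCell.mk (𝟙_ Obj) (𝟙_ Obj) (unit (𝟙_ Obj)))) α ≫ (tensorLeft M'.cell).hom =
      (tensorLeft M.cell).hom ≫ α
  tensorRight {A B : Obj} (M : Hor A B) :
    HCell.mk (A ⊗ 𝟙_ Obj) (B ⊗ 𝟙_ Obj) (tensor M (unit (𝟙_ Obj))) ≅ HCell.mk A B M
  srcMap_tensorRight {A B : Obj} (M : Hor A B) : srcMap (tensorRight M).hom = (ρ_ A).hom
  tgtMap_tensorRight {A B : Obj} (M : Hor A B) : tgtMap (tensorRight M).hom = (ρ_ B).hom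
  tensorRight_naturality {M M' : HCell Hor} (α : M ⟶ M') :
    tensorMap α (𝟙 (HCell.mk (𝟙_ Obj) (𝟙_ Obj) (unit (𝟙_ Obj)))) ≫ (tensorRight M'.cell).hom =
      (tensorRight M.cell).hom ≫ α
  tensorBraiding {A B A' B' : Obj} (M : Hor A B) (N : Hor A' B') :
    HCell.mk (A ⊗ A') (B ⊗ B') (tensor M N) ≅ HCell.mk (A' ⊗ A) (B' ⊗ B) (tensor N M)
  srcMap_tensorBraiding {A B A' B' : Obj} (M : Hor A B) (N : Hor A' B') :
    srcMap (tensorBraiding M N).hom = (β_ A A').hom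
  tgtMap_tensorBraiding {A B A' B' : Obj} (M : Hor A B) (N : Hor A' B') :
    tgtMap (tensorBraiding M N).hom = (β_ B B').hom
  tensorBraiding_naturality {M N M' N' : HCell Hor} (α : M ⟶ M') (β : N ⟶ N') :
    tensorMap α β ≫ (tensorBraiding M'.cell N'.cell).hom =
      (tensorBraiding M.cell N.cell).hom ≫ tensorMap β α
  -- coherence in the category of arrows
  tensor_pentagon (W X Y Z : HCell Hor) :
    tensorMap (tensorAssoc W.cell X.cell Y.cell).hom (𝟙 Z) ≫
        (tensorAssoc W.cell (tensor X.cell Y.cell) Z.cell).hom ≫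
          tensorMap (𝟙 W) (tensorAssoc X.cell Y.cell Z.cell).hom =
      (tensorAssoc (tensor W.cell X.cell) Y.cell Z.cell).hom ≫
        (tensorAssoc W.cell X.cell (tensor Y.cell Z.cell)).hom
  tensor_triangle (M N : HCell Hor) :
    (tensorAssoc M.cell (unit (𝟙_ Obj)) N.cell).hom ≫ tensorMap (𝟙 M) (tensorLeft N.cell).hom =
      tensorMap (tensorRight M.cell).hom (𝟙 N)
  tensor_hexagon (M N P : HCell Hor) :
    (tensorAssoc M.cell N.cell P.cell).hom ≫
        (tensorBraiding M.cell (tensor N.cell P.cell)).hom ≫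
          (tensorAssoc N.cell P.cell M.cell).hom =
      tensorMap (tensorBraiding M.cell N.cell).hom (𝟙 P) ≫
        (tensorAssoc N.cell M.cell P.cell).hom ≫
          tensorMap (𝟙 N) (tensorBraiding M.cell P.cell).hom
  tensor_hexagon_reverse (M N P : HCell Hor) :
    (tensorAssoc M.cell N.cell P.cell).inv ≫
        (tensorBraiding (tensor M.cell N.cell) P.cell).hom ≫
          (tensorAssoc P.cell M.cell N.cell).inv =
      tensorMap (𝟙 M) (tensorBraiding N.cell P.cell).hom ≫
        (tensorAssoc M.cell P.cell N.cell).inv ≫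
          tensorMap (tensorBraiding M.cell P.cell).hom (𝟙 N)
  tensor_symmetry (M N : HCell Hor) :
    (tensorBraiding M.cell N.cell).hom ≫ (tensorBraiding N.cell M.cell).hom = 𝟙 _
  -- the comparisons of the tensor product
  χ {A B C A' B' C' : Obj} (M₁ : Hor B C) (N₁ : Hor B' C') (M₂ : Hor A B) (N₂ : Hor A' B') :
    HCell.mk (A ⊗ A') (C ⊗ C') (comp (tensor M₁ N₁) (tensor M₂ N₂)) ≅
      HCell.mk (A ⊗ A') (C ⊗ C') (tensor (comp M₁ M₂) (comp N₁ N₂))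
  srcMap_χ {A B C A' B' C' : Obj} (M₁ : Hor B C) (N₁ : Hor B' C') (M₂ : Hor A B)
    (N₂ : Hor A' B') : srcMap (χ M₁ N₁ M₂ N₂).hom = 𝟙 (A ⊗ A')
  tgtMap_χ {A B C A' B' C' : Obj} (M₁ : Hor B C) (N₁ : Hor B' C') (M₂ : Hor A B)
    (N₂ : Hor A' B') : tgtMap (χ M₁ N₁ M₂ N₂).hom = 𝟙 (C ⊗ C')
  χ_naturality {A B C A' B' C' D E F D' E' F' : Obj}
    {M₁ : Hor B C} {N₁ : Hor B' C'} {M₂ : Hor A B} {N₂ : Hor A' B'}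
    {P₁ : Hor E F} {Q₁ : Hor E' F'} {P₂ : Hor D E} {Q₂ : Hor D' E'}
    (α₁ : HCell.mk B C M₁ ⟶ HCell.mk E F P₁) (β₁ : HCell.mk B' C' N₁ ⟶ HCell.mk E' F' Q₁)
    (α₂ : HCell.mk A B M₂ ⟶ HCell.mk D E P₂) (β₂ : HCell.mk A' B' N₂ ⟶ HCell.mk D' E' Q₂)
    (hα : srcMap α₁ = tgtMap α₂) (hβ : srcMap β₁ = tgtMap β₂) :
    compMap (tensorMap α₁ β₁) (tensorMap α₂ β₂)
        (by rw [srcMap_tensorMap, tgtMap_tensorMap, hα, hβ]) ≫ (χ P₁ Q₁ P₂ Q₂).hom =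
      (χ M₁ N₁ M₂ N₂).hom ≫ tensorMap (compMap α₁ α₂ hα) (compMap β₁ β₂ hβ)
  μ (A B : Obj) :
    HCell.mk (A ⊗ B) (A ⊗ B) (unit (A ⊗ B)) ≅ HCell.mk (A ⊗ B) (A ⊗ B) (tensor (unit A) (unit B))
  srcMap_μ (A B : Obj) : srcMap (μ A B).hom = 𝟙 (A ⊗ B)
  tgtMap_μ (A B : Obj) : tgtMap (μ A B).hom = 𝟙 (A ⊗ B)
  μ_naturality {A B A' B' : Obj} (f : A ⟶ A') (g : B ⟶ B') :
    unitMap (f ⊗ₘ g) ≫ (μ A' B').hom = (μ A B).hom ≫ tensorMap (unitMap f) (unitMap g)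
  -- the tensor product is a double functor
  χ_assoc {A B C D A' B' C' D' : Obj} (M₁ : Hor C D) (N₁ : Hor C' D') (M₂ : Hor B C)
    (N₂ : Hor B' C') (M₃ : Hor A B) (N₃ : Hor A' B') :
    compMap (χ M₁ N₁ M₂ N₂).hom (𝟙 (HCell.mk _ _ (tensor M₃ N₃)))
          ((srcMap_χ _ _ _ _).trans (tgtMap_id ⟨_, _, tensor M₃ N₃⟩).symm) ≫
        (χ (comp M₁ M₂) (comp N₁ N₂) M₃ N₃).hom ≫
          tensorMap (assoc M₁ M₂ M₃).hom (assoc N₁ N₂ N₃).hom =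
      (assoc (tensor M₁ N₁) (tensor M₂ N₂) (tensor M₃ N₃)).hom ≫
        compMap (𝟙 (HCell.mk _ _ (tensor M₁ N₁))) (χ M₂ N₂ M₃ N₃).hom
            ((srcMap_id ⟨_, _, tensor M₁ N₁⟩).trans (tgtMap_χ _ _ _ _).symm) ≫
          (χ M₁ N₁ (comp M₂ M₃) (comp N₂ N₃)).hom
  χ_rightUnitor {A B A' B' : Obj} (M : Hor A B) (N : Hor A' B') :
    compMap (𝟙 (HCell.mk _ _ (tensor M N))) (μ A A').hom
          ((srcMap_id ⟨_, _, tensor M N⟩).trans (tgtMap_μ _ _).symm) ≫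
        (χ M N (unit A) (unit A')).hom ≫ tensorMap (rightUnitor M).hom (rightUnitor N).hom =
      (rightUnitor (tensor M N)).hom
  χ_leftUnitor {A B A' B' : Obj} (M : Hor A B) (N : Hor A' B') :
    compMap (μ B B').hom (𝟙 (HCell.mk _ _ (tensor M N)))
          ((srcMap_μ _ _).trans (tgtMap_id ⟨_, _, tensor M N⟩).symm) ≫
        (χ (unit B) (unit B') M N).hom ≫ tensorMap (leftUnitor M).hom (leftUnitor N).hom =
      (leftUnitor (tensor M N)).hom
  -- the associator of the tensor product is a transformation
  tensorAssoc_χ {A B C A' B' C' A'' B'' C'' : Obj} (M₁ : Hor B C) (N₁ : Hor B' C')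
    (P₁ : Hor B'' C'') (M₂ : Hor A B) (N₂ : Hor A' B') (P₂ : Hor A'' B'') :
    compMap (tensorAssoc M₁ N₁ P₁).hom (tensorAssoc M₂ N₂ P₂).hom
          ((srcMap_tensorAssoc _ _ _).trans (tgtMap_tensorAssoc _ _ _).symm) ≫
        (χ M₁ (tensor N₁ P₁) M₂ (tensor N₂ P₂)).hom ≫
          tensorMap (𝟙 (HCell.mk _ _ (comp M₁ M₂))) (χ N₁ P₁ N₂ P₂).hom =
      (χ (tensor M₁ N₁) P₁ (tensor M₂ N₂) P₂).hom ≫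
        tensorMap (χ M₁ N₁ M₂ N₂).hom (𝟙 (HCell.mk _ _ (comp P₁ P₂))) ≫
          (tensorAssoc (comp M₁ M₂) (comp N₁ N₂) (comp P₁ P₂)).hom
  tensorAssoc_μ (A B C : Obj) :
    unitMap (α_ A B C).hom ≫ (μ A (B ⊗ C)).hom ≫
        tensorMap (𝟙 (HCell.mk _ _ (unit A))) (μ B C).hom =
      (μ (A ⊗ B) C).hom ≫ tensorMap (μ A B).hom (𝟙 (HCell.mk _ _ (unit C))) ≫
        (tensorAssoc (unit A) (unit B) (unit C)).hom
  -- the unitors of the tensor product are transformations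
  tensorLeft_χ {A B C : Obj} (M : Hor B C) (N : Hor A B) :
    compMap (tensorLeft M).hom (tensorLeft N).hom
        ((srcMap_tensorLeft _).trans (tgtMap_tensorLeft _).symm) =
      (χ (unit (𝟙_ Obj)) M (unit (𝟙_ Obj)) N).hom ≫
        tensorMap (leftUnitor (unit (𝟙_ Obj))).hom (𝟙 (HCell.mk _ _ (comp M N))) ≫
          (tensorLeft (comp M N)).hom
  tensorLeft_μ (A : Obj) :
    unitMap (λ_ A).hom = (μ (𝟙_ Obj) A).hom ≫ (tensorLeft (unit A)).hom
  tensorRight_χ {A B C : Obj} (M : Hor B C) (N : Hor A B) :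
    compMap (tensorRight M).hom (tensorRight N).hom
        ((srcMap_tensorRight _).trans (tgtMap_tensorRight _).symm) =
      (χ M (unit (𝟙_ Obj)) N (unit (𝟙_ Obj))).hom ≫
        tensorMap (𝟙 (HCell.mk _ _ (comp M N))) (leftUnitor (unit (𝟙_ Obj))).hom ≫
          (tensorRight (comp M N)).hom
  tensorRight_μ (A : Obj) :
    unitMap (ρ_ A).hom = (μ A (𝟙_ Obj)).hom ≫ (tensorRight (unit A)).hom
  -- the braiding is a transformation
  tensorBraiding_χ {A B C A' B' C' : Obj} (M₁ : Hor B C) (N₁ : Hor B' C') (M₂ : Hor A B)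
    (N₂ : Hor A' B') :
    compMap (tensorBraiding M₁ N₁).hom (tensorBraiding M₂ N₂).hom
          ((srcMap_tensorBraiding _ _).trans (tgtMap_tensorBraiding _ _).symm) ≫
        (χ N₁ M₁ N₂ M₂).hom =
      (χ M₁ N₁ M₂ N₂).hom ≫ (tensorBraiding (comp M₁ M₂) (comp N₁ N₂)).hom
  tensorBraiding_μ (A B : Obj) :
    unitMap (β_ A B).hom ≫ (μ B A).hom = (μ A B).hom ≫ (tensorBraiding (unit A) (unit B)).hom

attribute [instance] SymmetricMonoidalDoubleCategory.monObj SymmetricMonoidalDoubleCategory.symmObj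

namespace SymmetricMonoidalDoubleCategory

variable (D : SymmetricMonoidalDoubleCategory.{u₀, v₀, w₀, z₀})

/-- The tensor product on the category of arrows. -/
instance arrMonoidalStruct : MonoidalCategoryStruct (HCell D.Hor) where
  tensorObj M N := HCell.mk (M.src ⊗ N.src) (M.tgt ⊗ N.tgt) (D.tensor M.cell N.cell)
  whiskerLeft M _ _ β := D.tensorMap (𝟙 M) β
  whiskerRight α N := D.tensorMap α (𝟙 N)
  tensorHom α β := D.tensorMap α β
  tensorUnit := HCell.mk _ _ (D.unit (𝟙_ D.Obj))
  associator M N P := D.tensorAssoc M.cell N.cell P.cell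
  leftUnitor M := D.tensorLeft M.cell
  rightUnitor M := D.tensorRight M.cell

/-- The category of arrows is a monoidal category. -/
instance arrMonoidal : MonoidalCategory (HCell D.Hor) :=
  MonoidalCategory.ofTensorHom (C := HCell D.Hor)
    (id_tensorHom_id := D.tensorMap_id)
    (id_tensorHom := fun _ _ _ _ => rfl)
    (tensorHom_id := fun _ _ => rfl)
    (tensorHom_comp_tensorHom := fun α β α' β' => D.tensorMap_comp α β α' β')
    (associator_naturality := fun α β γ => D.tensorAssoc_naturality α β γ)
    (leftUnitor_naturality := fun α => D.tensorLeft_naturality α)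
    (rightUnitor_naturality := fun α => D.tensorRight_naturality α)
    (pentagon := D.tensor_pentagon)
    (triangle := D.tensor_triangle)

/-- The category of arrows is a symmetric monoidal category. -/
instance arrSymmetric : SymmetricCategory (HCell D.Hor) where
  braiding M N := D.tensorBraiding M.cell N.cell
  braiding_naturality_right M _ _ β := D.tensorBraiding_naturality (𝟙 M) β
  braiding_naturality_left α N := D.tensorBraiding_naturality α (𝟙 N)
  hexagon_forward := D.tensor_hexagon
  hexagon_reverse := D.tensor_hexagon_reverse
  symmetry := D.tensor_symmetry

end SymmetricMonoidalDoubleCategory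

/-! ## Lax double functors -/

/-- A pair of functors `F₀`, `F₁` between the categories of objects and the categories of arrows,
with `S ∘ F₁ = F₀ ∘ S` and `T ∘ F₁ = F₀ ∘ T`: the data of a lax double functor without its
comparisons. -/
structure DoubleFunctorData (C : DoubleCategory.{u, v, w, z}) (D : DoubleCategory.{u₀, v₀, w₀, z₀})
    where
  F₀ : C.Obj ⥤ D.Obj
  hor {A B : C.Obj} (M : C.Hor A B) : D.Hor (F₀.obj A) (F₀.obj B)
  sq {M N : HCell C.Hor} (α : M ⟶ N) :
    HCell.mk (F₀.obj M.src) (F₀.obj M.tgt) (hor M.cell) ⟶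
      HCell.mk (F₀.obj N.src) (F₀.obj N.tgt) (hor N.cell)
  srcMap_sq {M N : HCell C.Hor} (α : M ⟶ N) : D.srcMap (sq α) = F₀.map (C.srcMap α)
  tgtMap_sq {M N : HCell C.Hor} (α : M ⟶ N) : D.tgtMap (sq α) = F₀.map (C.tgtMap α)
  sq_id (M : HCell C.Hor) : sq (𝟙 M) = 𝟙 _
  sq_comp {M N K : HCell C.Hor} (α : M ⟶ N) (β : N ⟶ K) : sq (α ≫ β) = sq α ≫ sq β

namespace DoubleFunctorData

/-- The functor between the categories of arrows. -/
def F₁ {C : DoubleCategory.{u, v, w, z}} {D : DoubleCategory.{u₀, v₀, w₀, z₀}}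
    (F : DoubleFunctorData C D) : HCell C.Hor ⥤ HCell D.Hor where
  obj M := HCell.mk (F.F₀.obj M.src) (F.F₀.obj M.tgt) (F.hor M.cell)
  map α := F.sq α
  map_id M := F.sq_id M
  map_comp α β := F.sq_comp α β

/-- The comparisons, subject to their axioms, that make `F` a lax double functor. -/
structure LaxStructure {C : DoubleCategory.{u, v, w, z}} {D : DoubleCategory.{u₀, v₀, w₀, z₀}}
    (F : DoubleFunctorData C D) where
  /-- composition comparison -/
  φ {X Y Z : C.Obj} (N : C.Hor Y Z) (N' : C.Hor X Y) :
    HCell.mk (F.F₀.obj X) (F.F₀.obj Z) (D.comp (F.hor N) (F.hor N')) ⟶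
      HCell.mk (F.F₀.obj X) (F.F₀.obj Z) (F.hor (C.comp N N'))
  srcMap_φ {X Y Z : C.Obj} (N : C.Hor Y Z) (N' : C.Hor X Y) : D.srcMap (φ N N') = 𝟙 _
  tgtMap_φ {X Y Z : C.Obj} (N : C.Hor Y Z) (N' : C.Hor X Y) : D.tgtMap (φ N N') = 𝟙 _
  φ_naturality {X Y Z X' Y' Z' : C.Obj} {N : C.Hor Y Z} {M : C.Hor X Y} {N' : C.Hor Y' Z'}
    {M' : C.Hor X' Y'} (β : HCell.mk Y Z N ⟶ HCell.mk Y' Z' N')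
    (α : HCell.mk X Y M ⟶ HCell.mk X' Y' M') (h : C.srcMap β = C.tgtMap α) :
    D.compMap (F.sq β) (F.sq α) (by rw [F.srcMap_sq, F.tgtMap_sq, h]) ≫ φ N' M' =
      φ N M ≫ F.sq (C.compMap β α h)
  /-- identity comparison -/
  φ₀ (X : C.Obj) :
    HCell.mk (F.F₀.obj X) (F.F₀.obj X) (D.unit (F.F₀.obj X)) ⟶
      HCell.mk (F.F₀.obj X) (F.F₀.obj X) (F.hor (C.unit X))
  srcMap_φ₀ (X : C.Obj) : D.srcMap (φ₀ X) = 𝟙 _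
  tgtMap_φ₀ (X : C.Obj) : D.tgtMap (φ₀ X) = 𝟙 _
  φ₀_naturality {X Y : C.Obj} (f : X ⟶ Y) :
    D.unitMap (F.F₀.map f) ≫ φ₀ Y = φ₀ X ≫ F.sq (C.unitMap f)
  /-- compatibility with the associators -/
  φ_assoc {X Y Z W : C.Obj} (N : C.Hor Z W) (N' : C.Hor Y Z) (N'' : C.Hor X Y) :
    D.compMap (φ N N') (𝟙 (HCell.mk _ _ (F.hor N''))) ((srcMap_φ _ _).trans (D.tgtMap_id ⟨_, _, F.hor N''⟩).symm) ≫
        φ (C.comp N N') N'' ≫ F.sq (C.assoc N N' N'').hom =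
      (D.assoc (F.hor N) (F.hor N') (F.hor N'')).hom ≫
        D.compMap (𝟙 (HCell.mk _ _ (F.hor N))) (φ N' N'')
            ((D.srcMap_id ⟨_, _, F.hor N⟩).trans (tgtMap_φ _ _).symm) ≫
          φ N (C.comp N' N'')
  /-- compatibility with the right unitors -/
  φ_rightUnitor {X Y : C.Obj} (N : C.Hor X Y) :
    D.compMap (𝟙 (HCell.mk _ _ (F.hor N))) (φ₀ X) ((D.srcMap_id ⟨_, _, F.hor N⟩).trans (tgtMap_φ₀ _).symm) ≫
        φ N (C.unit X) ≫ F.sq (C.rightUnitor N).hom =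
      (D.rightUnitor (F.hor N)).hom
  /-- compatibility with the left unitors -/
  φ_leftUnitor {X Y : C.Obj} (N : C.Hor X Y) :
    D.compMap (φ₀ Y) (𝟙 (HCell.mk _ _ (F.hor N))) ((srcMap_φ₀ _).trans (D.tgtMap_id ⟨_, _, F.hor N⟩).symm) ≫
        φ (C.unit Y) N ≫ F.sq (C.leftUnitor N).hom =
      (D.leftUnitor (F.hor N)).hom

end DoubleFunctorData

open Functor.LaxMonoidal in
/-- The structure that makes a lax double functor, given by `F` and its comparisons `Φ`, into a
symmetric monoidal lax double functor: `F₀` and `F₁` are (strong) symmetric monoidal functors,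
`S ∘ F₁ = F₀ ∘ S` and `T ∘ F₁ = F₀ ∘ T` as monoidal functors, and the two comparisons are monoidal
natural transformations. -/
structure SymmetricMonoidalStructure {C : SymmetricMonoidalDoubleCategory.{u, v, w, z}}
    {D : SymmetricMonoidalDoubleCategory.{u₀, v₀, w₀, z₀}}
    (F : DoubleFunctorData C.toDoubleCategory D.toDoubleCategory) (Φ : F.LaxStructure) where
  [braided₀ : F.F₀.Braided]
  [braided₁ : F.F₁.Braided]
  srcMap_ε : D.srcMap (ε F.F₁) = ε F.F₀
  tgtMap_ε : D.tgtMap (ε F.F₁) = ε F.F₀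
  srcMap_μ (M N : HCell C.Hor) : D.srcMap (μ F.F₁ M N) = μ F.F₀ M.src N.src
  tgtMap_μ (M N : HCell C.Hor) : D.tgtMap (μ F.F₁ M N) = μ F.F₀ M.tgt N.tgt
  /-- the composition comparison is compatible with the tensor products -/
  φ_tensor {X Y Z X' Y' Z' : C.Obj} (M₁ : C.Hor Y Z) (N₁ : C.Hor X Y) (M₂ : C.Hor Y' Z')
    (N₂ : C.Hor X' Y') :
    (D.χ (F.hor M₁) (F.hor M₂) (F.hor N₁) (F.hor N₂)).hom ≫
        D.tensorMap (Φ.φ M₁ N₁) (Φ.φ M₂ N₂) ≫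
          μ F.F₁ (HCell.mk _ _ (C.comp M₁ N₁)) (HCell.mk _ _ (C.comp M₂ N₂)) =
      D.compMap (μ F.F₁ (HCell.mk _ _ M₁) (HCell.mk _ _ M₂))
            (μ F.F₁ (HCell.mk _ _ N₁) (HCell.mk _ _ N₂))
            ((srcMap_μ _ _).trans (tgtMap_μ ⟨_, _, N₁⟩ ⟨_, _, N₂⟩).symm) ≫
          Φ.φ (C.tensor M₁ M₂) (C.tensor N₁ N₂) ≫ F.sq (C.χ M₁ M₂ N₁ N₂).hom
  /-- the composition comparison is compatible with the tensor units -/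
  φ_unit :
    D.compMap (ε F.F₁) (ε F.F₁) (srcMap_ε.trans tgtMap_ε.symm) ≫
        Φ.φ (C.unit (𝟙_ C.Obj)) (C.unit (𝟙_ C.Obj)) ≫
          F.sq (C.leftUnitor (C.unit (𝟙_ C.Obj))).hom =
      (D.leftUnitor (D.unit (𝟙_ D.Obj))).hom ≫ ε F.F₁
  /-- the identity comparison is compatible with the tensor products -/
  φ₀_tensor (X Y : C.Obj) :
    (D.μ (F.F₀.obj X) (F.F₀.obj Y)).hom ≫ D.tensorMap (Φ.φ₀ X) (Φ.φ₀ Y) ≫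
        μ F.F₁ (HCell.mk _ _ (C.unit X)) (HCell.mk _ _ (C.unit Y)) =
      D.unitMap (μ F.F₀ X Y) ≫ Φ.φ₀ (X ⊗ Y) ≫ F.sq (C.μ X Y).hom
  /-- the identity comparison is compatible with the tensor units -/
  φ₀_unit : D.unitMap (ε F.F₀) ≫ Φ.φ₀ (𝟙_ C.Obj) = ε F.F₁

/-! ## The symmetric monoidal double category of relations -/

/-- A 2-morphism of relations: functions `left`, `right` with `(left × right) R ⊆ S`. -/
@[ext]
structure RelSquare (R S : HCell fun X Y : Type u => Set (X × Y)) where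
  left : R.src ⟶ S.src
  right : R.tgt ⟶ S.tgt
  sub : ∀ x y, (x, y) ∈ R.cell → (left x, right y) ∈ S.cell

namespace RelSquare

instance category : Category (HCell fun X Y : Type u => Set (X × Y)) where
  Hom := RelSquare
  id R := ⟨𝟙 _, 𝟙 _, fun _ _ h => h⟩
  comp α β := ⟨α.left ≫ β.left, α.right ≫ β.right, fun _ _ h => β.sub _ _ (α.sub _ _ h)⟩

theorem hom_ext {R S : HCell fun X Y : Type u => Set (X × Y)} {α β : R ⟶ S}
    (h : RelSquare.left α = RelSquare.left β) (h' : RelSquare.right α = RelSquare.right β) :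
    α = β :=
  RelSquare.ext h h'

/-- An invertible 2-morphism of relations. -/
def iso {X Y X' Y' : Type u} {R : Set (X × Y)} {S : Set (X' × Y')} (e : X ≅ X') (e' : Y ≅ Y')
    (h : ∀ x y, (x, y) ∈ R → (e.hom x, e'.hom y) ∈ S)
    (h' : ∀ x y, (x, y) ∈ S → (e.inv x, e'.inv y) ∈ R) :
    (HCell.mk X Y R : HCell fun X Y : Type u => Set (X × Y)) ≅ HCell.mk X' Y' S where
  hom := ⟨e.hom, e'.hom, h⟩
  inv := ⟨e.inv, e'.inv, h'⟩
  hom_inv_id := hom_ext e.hom_inv_id e'.hom_inv_id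
  inv_hom_id := hom_ext e.inv_hom_id e'.inv_hom_id

end RelSquare

/-- The symmetric monoidal double category of relations.  Objects are sets, vertical
1-morphisms are functions, horizontal 1-cells are relations `R ⊆ X × Y`, and 2-morphisms are squares
with `(f × g) R ⊆ S`.  The tensor product of sets is the cartesian
product, and the tensor product of relations is
`R × S = {((x, x'), (y, y')) | (x, y) ∈ R, (x', y') ∈ S}`. -/
def RelDouble : SymmetricMonoidalDoubleCategory.{u + 1, u, u, u} where
  Obj := Type u
  Hor X Y := Set (X × Y)
  srcMap α := RelSquare.left α
  tgtMap α := RelSquare.right α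
  srcMap_id _ := rfl
  tgtMap_id _ := rfl
  srcMap_comp _ _ := rfl
  tgtMap_comp _ _ := rfl
  unit X := {p | p.1 = p.2}
  unitMap f := ⟨f, f, fun _ _ h => congrArg f h⟩
  srcMap_unitMap _ := rfl
  tgtMap_unitMap _ := rfl
  unitMap_id _ := rfl
  unitMap_comp _ _ := rfl
  comp N M := {p | ∃ y, (p.1, y) ∈ M ∧ (y, p.2) ∈ N}
  compMap {_ _ _ _ _ _ N M N' M'} β α h := ⟨RelSquare.left (R := ⟨_, _, M⟩) (S := ⟨_, _, M'⟩) α,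
      RelSquare.right (R := ⟨_, _, N⟩) (S := ⟨_, _, N'⟩) β, by
    rintro x z ⟨y, hM, hN⟩
    refine ⟨RelSquare.right α y, RelSquare.sub α _ _ hM, ?_⟩
    have := RelSquare.sub β _ _ hN
    rwa [h] at this⟩
  srcMap_compMap _ _ _ := rfl
  tgtMap_compMap _ _ _ := rfl
  compMap_id _ _ := rfl
  compMap_comp _ _ _ _ _ _ := rfl
  assoc N N' N'' := RelSquare.iso (Iso.refl _) (Iso.refl _)
    (fun _ _ ⟨b, h, c, h', h''⟩ => ⟨c, ⟨b, h, h'⟩, h''⟩)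
    (fun _ _ ⟨c, ⟨b, h, h'⟩, h''⟩ => ⟨b, h, c, h', h''⟩)
  srcMap_assoc _ _ _ := rfl
  tgtMap_assoc _ _ _ := rfl
  assoc_naturality _ _ _ _ _ := rfl
  leftUnitor N := RelSquare.iso (Iso.refl _) (Iso.refl _)
    (by rintro x y ⟨z, h, h'⟩; cases h'; exact h)
    (fun _ y h => ⟨y, h, rfl⟩)
  srcMap_leftUnitor _ := rfl
  tgtMap_leftUnitor _ := rfl
  leftUnitor_naturality _ := rfl
  rightUnitor N := RelSquare.iso (Iso.refl _) (Iso.refl _)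
    (by rintro x y ⟨z, h, h'⟩; cases h; exact h')
    (fun x _ h => ⟨x, rfl, h⟩)
  srcMap_rightUnitor _ := rfl
  tgtMap_rightUnitor _ := rfl
  rightUnitor_naturality _ := rfl
  pentagon _ _ _ _ := rfl
  triangle _ _ := rfl
  monObj := inferInstanceAs (MonoidalCategory (Type u))
  symmObj := inferInstanceAs (SymmetricCategory (Type u))
  tensor R S := {p | (p.1.1, p.2.1) ∈ R ∧ (p.1.2, p.2.2) ∈ S}
  tensorMap α β := ⟨RelSquare.left α ⊗ₘ RelSquare.left β, RelSquare.right α ⊗ₘ RelSquare.right β,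
    fun _ _ h => ⟨RelSquare.sub α _ _ h.1, RelSquare.sub β _ _ h.2⟩⟩
  srcMap_tensorMap _ _ := rfl
  tgtMap_tensorMap _ _ := rfl
  tensorMap_id _ _ := rfl
  tensorMap_comp _ _ _ _ := rfl
  tensorAssoc {A B A' B' A'' B''} R S T :=
    RelSquare.iso (α_ A A' A'') (α_ B B' B'')
      (fun _ _ h => ⟨h.1.1, h.1.2, h.2⟩) (fun _ _ h => ⟨⟨h.1, h.2.1⟩, h.2.2⟩)
  srcMap_tensorAssoc _ _ _ := rfl
  tgtMap_tensorAssoc _ _ _ := rfl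
  tensorAssoc_naturality _ _ _ := rfl
  tensorLeft {A B} R := RelSquare.iso (λ_ A) (λ_ B)
    (fun _ _ h => h.2) (fun _ _ h => ⟨rfl, h⟩)
  srcMap_tensorLeft _ := rfl
  tgtMap_tensorLeft _ := rfl
  tensorLeft_naturality _ := rfl
  tensorRight {A B} R := RelSquare.iso (ρ_ A) (ρ_ B)
    (fun _ _ h => h.1) (fun _ _ h => ⟨h, rfl⟩)
  srcMap_tensorRight _ := rfl
  tgtMap_tensorRight _ := rfl
  tensorRight_naturality _ := rfl
  tensorBraiding {A B A' B'} R S := RelSquare.iso (β_ A A') (β_ B B')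
    (fun _ _ h => ⟨h.2, h.1⟩) (fun _ _ h => ⟨h.2, h.1⟩)
  srcMap_tensorBraiding _ _ := rfl
  tgtMap_tensorBraiding _ _ := rfl
  tensorBraiding_naturality _ _ := rfl
  tensor_pentagon _ _ _ _ := rfl
  tensor_triangle _ _ := rfl
  tensor_hexagon _ _ _ := rfl
  tensor_hexagon_reverse _ _ _ := rfl
  tensor_symmetry _ _ := rfl
  χ R₁ S₁ R₂ S₂ := RelSquare.iso (Iso.refl _) (Iso.refl _)
    (fun _ _ ⟨y, h, h'⟩ => ⟨⟨y.1, h.1, h'.1⟩, ⟨y.2, h.2, h'.2⟩⟩)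
    (fun _ _ ⟨⟨y, h, h'⟩, ⟨z, k, k'⟩⟩ => ⟨(y, z), ⟨h, k⟩, ⟨h', k'⟩⟩)
  srcMap_χ _ _ _ _ := rfl
  tgtMap_χ _ _ _ _ := rfl
  χ_naturality _ _ _ _ _ _ := rfl
  μ X Y := RelSquare.iso (Iso.refl _) (Iso.refl _)
    (fun _ _ h => ⟨congrArg Prod.fst h, congrArg Prod.snd h⟩)
    (fun _ _ h => Prod.ext h.1 h.2)
  srcMap_μ _ _ := rfl
  tgtMap_μ _ _ := rfl
  μ_naturality _ _ := rfl
  χ_assoc _ _ _ _ _ _ := rfl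
  χ_rightUnitor _ _ := rfl
  χ_leftUnitor _ _ := rfl
  tensorAssoc_χ _ _ _ _ _ _ := rfl
  tensorAssoc_μ _ _ _ := rfl
  tensorLeft_χ _ _ := rfl
  tensorLeft_μ _ := rfl
  tensorRight_χ _ _ := rfl
  tensorRight_μ _ := rfl
  tensorBraiding_χ _ _ _ _ := rfl
  tensorBraiding_μ _ _ := rfl

/-! ## Petri nets -/

/-- `ℕ[X]` is the set of finite multisets in `X`, the underlying set of the free commutative monoid
on `X`; this is the endofunctor `ℕ[-]` of the category of sets. -/
def markingFunctor : Type u ⥤ Type u where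
  obj X := Multiset X
  map f := ↾fun m => Multiset.map f m
  map_id X := by ext m; exact Multiset.map_id m
  map_comp f g := by ext m; exact (Multiset.map_map g f m).symm

/-- A Petri net: a pair of functions `source, target : trans → ℕ[places]`. -/
structure Petri where
  trans : Type u
  places : Type u
  source : trans → Multiset places
  target : trans → Multiset places

namespace Petri

/-- A morphism of Petri nets. -/
@[ext]
structure Hom (P Q : Petri.{u}) where
  onTrans : P.trans → Q.trans
  onPlaces : P.places → Q.places
  source_comm : ∀ τ, (P.source τ).map onPlaces = Q.source (onTrans τ)
  target_comm : ∀ τ, (P.target τ).map onPlaces = Q.target (onTrans τ)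

instance category : Category Petri.{u} where
  Hom := Hom
  id P := ⟨id, id, fun τ => Multiset.map_id _, fun τ => Multiset.map_id _⟩
  comp f g := ⟨g.onTrans ∘ f.onTrans, g.onPlaces ∘ f.onPlaces,
    fun τ => by rw [← Multiset.map_map, f.source_comm, g.source_comm]; rfl,
    fun τ => by rw [← Multiset.map_map, f.target_comm, g.target_comm]; rfl⟩

theorem hom_ext {P Q : Petri.{u}} {f g : P ⟶ Q} (h : ∀ τ, Hom.onTrans f τ = Hom.onTrans g τ)
    (h' : ∀ p, Hom.onPlaces f p = Hom.onPlaces g p) : f = g :=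
  Hom.ext (funext h) (funext h')

/-- The functor `L` from sets to Petri nets: `L X` has `X` as its set of places and no transitions. -/
def L : Type u ⥤ Petri.{u} where
  obj X := ⟨PEmpty, X, PEmpty.elim, PEmpty.elim⟩
  map f := ⟨id, f, fun τ => τ.elim, fun τ => τ.elim⟩
  map_id _ := rfl
  map_comp _ _ := rfl

/-- The functor `R` from Petri nets to sets, sending a Petri net to its set of places. -/
def R : Petri.{u} ⥤ Type u where
  obj P := P.places
  map f := ↾(Hom.onPlaces f)

/-- `L` is left adjoint to `R`. -/
def adj : L.{u} ⊣ R.{u} :=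
  Adjunction.mkOfHomEquiv
    { homEquiv _ _ :=
        { toFun f := ↾(Hom.onPlaces f)
          invFun g := ⟨PEmpty.elim, g, fun τ => τ.elim, fun τ => τ.elim⟩
          left_inv _ := hom_ext (fun τ => τ.elim) (fun _ => rfl)
          right_inv _ := rfl }
      homEquiv_naturality_left_symm _ _ := hom_ext (fun τ => τ.elim) (fun _ => rfl)
      homEquiv_naturality_right _ _ := rfl }

/-- The chosen coproduct of two Petri nets. -/
def sum (P Q : Petri.{u}) : Petri.{u} where
  trans := P.trans ⊕ Q.trans
  places := P.places ⊕ Q.places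
  source := Sum.elim (fun τ => (P.source τ).map Sum.inl) (fun τ => (Q.source τ).map Sum.inr)
  target := Sum.elim (fun τ => (P.target τ).map Sum.inl) (fun τ => (Q.target τ).map Sum.inr)

/-- The first coprojection. -/
def sumInl (P Q : Petri.{u}) : P ⟶ P.sum Q := ⟨Sum.inl, Sum.inl, fun _ => rfl, fun _ => rfl⟩

/-- The second coprojection. -/
def sumInr (P Q : Petri.{u}) : Q ⟶ P.sum Q := ⟨Sum.inr, Sum.inr, fun _ => rfl, fun _ => rfl⟩

/-- The morphism out of the coproduct given by two morphisms. -/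
def sumDesc {P Q K : Petri.{u}} (f : P ⟶ K) (g : Q ⟶ K) : P.sum Q ⟶ K where
  onTrans := Sum.elim (Hom.onTrans f) (Hom.onTrans g)
  onPlaces := Sum.elim (Hom.onPlaces f) (Hom.onPlaces g)
  source_comm := by
    rintro (τ | τ)
    · exact (Multiset.map_map _ _ _).trans (Hom.source_comm f τ)
    · exact (Multiset.map_map _ _ _).trans (Hom.source_comm g τ)
  target_comm := by
    rintro (τ | τ)
    · exact (Multiset.map_map _ _ _).trans (Hom.target_comm f τ)
    · exact (Multiset.map_map _ _ _).trans (Hom.target_comm g τ)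

/-- `P.sum Q` is a coproduct of `P` and `Q`. -/
def sumIsColimit (P Q : Petri.{u}) :
    Limits.IsColimit (Limits.BinaryCofan.mk (sumInl P Q) (sumInr P Q)) :=
  Limits.BinaryCofan.IsColimit.mk _ (fun f g => sumDesc f g) (fun _ _ => rfl) (fun _ _ => rfl)
    (by
      rintro K f g m rfl rfl
      exact hom_ext (by rintro (τ | τ) <;> rfl) (by rintro (p | p) <;> rfl))

/-- The coproduct of two morphisms. -/
def sumMap {P Q P' Q' : Petri.{u}} (f : P ⟶ P') (g : Q ⟶ Q') : P.sum Q ⟶ P'.sum Q' :=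
  sumDesc (f ≫ sumInl P' Q') (g ≫ sumInr P' Q')

/-- The chosen pushout of `o : L Y ⟶ P` and `i : L Y ⟶ Q`: the places of `P` and `Q` are glued along
`Y`, and the transitions, which are glued along the empty set, form a disjoint union. -/
def glue {Y : Type u} {P Q : Petri.{u}} (o : L.obj Y ⟶ P) (i : L.obj Y ⟶ Q) : Petri.{u} where
  trans := P.trans ⊕ Q.trans
  places := Quot fun a b : P.places ⊕ Q.places =>
    ∃ y : Y, a = Sum.inl (Hom.onPlaces o y) ∧ b = Sum.inr (Hom.onPlaces i y)
  source := Sum.elim (fun τ => (P.source τ).map fun p => Quot.mk _ (Sum.inl p))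
    (fun τ => (Q.source τ).map fun p => Quot.mk _ (Sum.inr p))
  target := Sum.elim (fun τ => (P.target τ).map fun p => Quot.mk _ (Sum.inl p))
    (fun τ => (Q.target τ).map fun p => Quot.mk _ (Sum.inr p))

section glue

variable {Y : Type u} {P Q : Petri.{u}} (o : L.obj Y ⟶ P) (i : L.obj Y ⟶ Q)

/-- The first leg of the pushout cocone. -/
def glueInl : P ⟶ glue o i := ⟨Sum.inl, fun p => Quot.mk _ (Sum.inl p), fun _ => rfl, fun _ => rfl⟩

/-- The second leg of the pushout cocone. -/
def glueInr : Q ⟶ glue o i := ⟨Sum.inr, fun p => Quot.mk _ (Sum.inr p), fun _ => rfl, fun _ => rfl⟩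

theorem glue_condition : o ≫ glueInl o i = i ≫ glueInr o i :=
  hom_ext (fun τ => τ.elim) (fun y => Quot.sound ⟨y, rfl, rfl⟩)

variable {o i}

/-- The morphism out of the pushout given by two compatible morphisms. -/
def glueDesc {K : Petri.{u}} (f : P ⟶ K) (g : Q ⟶ K) (h : o ≫ f = i ≫ g) : glue o i ⟶ K where
  onTrans := Sum.elim (Hom.onTrans f) (Hom.onTrans g)
  onPlaces := Quot.lift (Sum.elim (Hom.onPlaces f) (Hom.onPlaces g)) (by
    rintro _ _ ⟨y, rfl, rfl⟩
    exact congrFun (congrArg Hom.onPlaces h) y)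
  source_comm := by
    rintro (τ | τ)
    · exact (Multiset.map_map _ _ _).trans (Hom.source_comm f τ)
    · exact (Multiset.map_map _ _ _).trans (Hom.source_comm g τ)
  target_comm := by
    rintro (τ | τ)
    · exact (Multiset.map_map _ _ _).trans (Hom.target_comm f τ)
    · exact (Multiset.map_map _ _ _).trans (Hom.target_comm g τ)

variable (o i)

/-- `glue o i` is a pushout of `o` and `i`. -/
theorem glue_isPushout : IsPushout o i (glueInl o i) (glueInr o i) :=
  ⟨⟨glue_condition o i⟩, ⟨Limits.PushoutCocone.IsColimit.mk _
    (fun s => glueDesc s.inl s.inr s.condition) (fun _ => rfl) (fun _ => rfl) (by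
      intro s m h h'
      refine hom_ext ?_ ?_
      · rintro (τ | τ)
        · exact congrFun (congrArg Hom.onTrans h) τ
        · exact congrFun (congrArg Hom.onTrans h') τ
      · rintro ⟨p | p⟩
        · exact congrFun (congrArg Hom.onPlaces h) p
        · exact congrFun (congrArg Hom.onPlaces h') p)⟩⟩

end glue

end Petri

/-! ## Open Petri nets -/

/-- An open Petri net from `X` to `Y`: a cospan `L X ⟶ P ⟵ L Y` of Petri nets. -/
structure OpenPetri (X Y : Type u) where
  apex : Petri.{u}
  inp : Petri.L.obj X ⟶ apex
  out : Petri.L.obj Y ⟶ apex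

/-- A 2-morphism of open Petri nets. -/
structure OpenPetriSquare (P Q : HCell OpenPetri.{u}) where
  left : P.src ⟶ Q.src
  right : P.tgt ⟶ Q.tgt
  apex : P.cell.apex ⟶ Q.cell.apex
  inp_comm : P.cell.inp ≫ apex = Petri.L.map left ≫ Q.cell.inp
  out_comm : P.cell.out ≫ apex = Petri.L.map right ≫ Q.cell.out

namespace OpenPetriSquare

instance category : Category (HCell OpenPetri.{u}) where
  Hom := OpenPetriSquare
  id P := ⟨𝟙 _, 𝟙 _, 𝟙 _, rfl, rfl⟩
  comp α β := ⟨α.left ≫ β.left, α.right ≫ β.right, α.apex ≫ β.apex,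
    by rw [← Category.assoc, α.inp_comm, Category.assoc, β.inp_comm]; rfl,
    by rw [← Category.assoc, α.out_comm, Category.assoc, β.out_comm]; rfl⟩

theorem hom_ext {P Q : HCell OpenPetri.{u}} {α β : P ⟶ Q}
    (h : ∀ x, OpenPetriSquare.left α x = OpenPetriSquare.left β x)
    (h' : ∀ x, OpenPetriSquare.right α x = OpenPetriSquare.right β x)
    (ht : ∀ τ, Petri.Hom.onTrans (OpenPetriSquare.apex α) τ =
      Petri.Hom.onTrans (OpenPetriSquare.apex β) τ)
    (hp : ∀ p, Petri.Hom.onPlaces (OpenPetriSquare.apex α) p =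
      Petri.Hom.onPlaces (OpenPetriSquare.apex β) p) :
    α = β := by
  obtain ⟨l, r, a, _, _⟩ := α
  obtain ⟨l', r', a', _, _⟩ := β
  obtain rfl : l = l' := by ext x; exact h x
  obtain rfl : r = r' := by ext x; exact h' x
  obtain rfl : a = a' := Petri.hom_ext ht hp
  rfl

/-- An invertible 2-morphism of open Petri nets. -/
def iso {X Y X' Y' : Type u} {P : OpenPetri X Y} {Q : OpenPetri X' Y'} (e : X ≅ X') (e' : Y ≅ Y')
    (a : P.apex ≅ Q.apex) (h : P.inp ≫ a.hom = Petri.L.map e.hom ≫ Q.inp)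
    (h' : P.out ≫ a.hom = Petri.L.map e'.hom ≫ Q.out) :
    (HCell.mk X Y P : HCell OpenPetri.{u}) ≅ HCell.mk X' Y' Q where
  hom := ⟨e.hom, e'.hom, a.hom, h, h'⟩
  inv := ⟨e.inv, e'.inv, a.inv,
    by rw [Iso.comp_inv_eq, Category.assoc, h, ← Category.assoc, ← Functor.map_comp]; simp,
    by rw [Iso.comp_inv_eq, Category.assoc, h', ← Category.assoc, ← Functor.map_comp]; simp⟩
  hom_inv_id := hom_ext (fun x => congrArg (fun f : X ⟶ X => f x) e.hom_inv_id)
    (fun x => congrArg (fun f : Y ⟶ Y => f x) e'.hom_inv_id)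
    (fun τ => congrFun (congrArg Petri.Hom.onTrans a.hom_inv_id) τ)
    (fun p => congrFun (congrArg Petri.Hom.onPlaces a.hom_inv_id) p)
  inv_hom_id := hom_ext (fun x => congrArg (fun f : X' ⟶ X' => f x) e.inv_hom_id)
    (fun x => congrArg (fun f : Y' ⟶ Y' => f x) e'.inv_hom_id)
    (fun τ => congrFun (congrArg Petri.Hom.onTrans a.inv_hom_id) τ)
    (fun p => congrFun (congrArg Petri.Hom.onPlaces a.inv_hom_id) p)

end OpenPetriSquare

namespace OpenPetri

/-- The identity open Petri net `L X ⟶ L X ⟵ L X`. -/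
def unit (X : Type u) : OpenPetri X X := ⟨Petri.L.obj X, 𝟙 _, 𝟙 _⟩

/-- The composite `Q ⊙ P`, by pushout. -/
def comp {X Y Z : Type u} (Q : OpenPetri Y Z) (P : OpenPetri X Y) : OpenPetri X Z :=
  ⟨Petri.glue P.out Q.inp, P.inp ≫ Petri.glueInl _ _, Q.out ≫ Petri.glueInr _ _⟩

/-- The morphism of pushouts induced by two horizontally composable 2-morphisms. -/
def compApex {X Y Z X' Y' Z' : Type u} {Q : OpenPetri Y Z} {P : OpenPetri X Y}
    {Q' : OpenPetri Y' Z'} {P' : OpenPetri X' Y'}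
    (β : (HCell.mk Y Z Q : HCell OpenPetri.{u}) ⟶ HCell.mk Y' Z' Q')
    (α : (HCell.mk X Y P : HCell OpenPetri.{u}) ⟶ HCell.mk X' Y' P')
    (h : OpenPetriSquare.left β = OpenPetriSquare.right α) :
    Petri.glue P.out Q.inp ⟶ Petri.glue P'.out Q'.inp :=
  Petri.glueDesc (OpenPetriSquare.apex α ≫ Petri.glueInl P'.out Q'.inp)
    (OpenPetriSquare.apex β ≫ Petri.glueInr P'.out Q'.inp) (by
      have h₁ : P.out ≫ OpenPetriSquare.apex α =
        Petri.L.map (OpenPetriSquare.right α) ≫ P'.out := OpenPetriSquare.out_comm α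
      have h₂ : Q.inp ≫ OpenPetriSquare.apex β =
        Petri.L.map (OpenPetriSquare.left β) ≫ Q'.inp := OpenPetriSquare.inp_comm β
      have h₃ := Petri.glue_condition P'.out Q'.inp
      calc P.out ≫ OpenPetriSquare.apex α ≫ Petri.glueInl P'.out Q'.inp
          = (P.out ≫ OpenPetriSquare.apex α) ≫ Petri.glueInl P'.out Q'.inp := rfl
        _ = (Petri.L.map (OpenPetriSquare.right α) ≫ P'.out) ≫ Petri.glueInl P'.out Q'.inp :=
          congrArg (· ≫ Petri.glueInl P'.out Q'.inp) h₁
        _ = Petri.L.map (OpenPetriSquare.right α) ≫ Q'.inp ≫ Petri.glueInr P'.out Q'.inp :=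
          congrArg (Petri.L.map (OpenPetriSquare.right α) ≫ ·) h₃
        _ = (Petri.L.map (OpenPetriSquare.left β) ≫ Q'.inp) ≫ Petri.glueInr P'.out Q'.inp := by
          rw [h]; rfl
        _ = Q.inp ≫ OpenPetriSquare.apex β ≫ Petri.glueInr P'.out Q'.inp :=
          congrArg (· ≫ Petri.glueInr P'.out Q'.inp) h₂.symm)

/-- The horizontal composite of 2-morphisms. -/
def compMap {X Y Z X' Y' Z' : Type u} {Q : OpenPetri Y Z} {P : OpenPetri X Y}
    {Q' : OpenPetri Y' Z'} {P' : OpenPetri X' Y'}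
    (β : (HCell.mk Y Z Q : HCell OpenPetri.{u}) ⟶ HCell.mk Y' Z' Q')
    (α : (HCell.mk X Y P : HCell OpenPetri.{u}) ⟶ HCell.mk X' Y' P')
    (h : OpenPetriSquare.left β = OpenPetriSquare.right α) :
    (HCell.mk X Z (comp Q P) : HCell OpenPetri.{u}) ⟶ HCell.mk X' Z' (comp Q' P') where
  left := OpenPetriSquare.left (P := ⟨_, _, P⟩) (Q := ⟨_, _, P'⟩) α
  right := OpenPetriSquare.right (P := ⟨_, _, Q⟩) (Q := ⟨_, _, Q'⟩) β
  apex := compApex β α h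
  inp_comm := congrArg (· ≫ Petri.glueInl P'.out Q'.inp) (OpenPetriSquare.inp_comm α)
  out_comm := congrArg (· ≫ Petri.glueInr P'.out Q'.inp) (OpenPetriSquare.out_comm β)

end OpenPetri

namespace Petri

/-- The canonical morphism `L (X + Y) ≅ L X + L Y ⟶ P + Q` given by `f : L X ⟶ P`, `g : L Y ⟶ Q`. -/
def sumL {X Y : Type u} {P Q : Petri.{u}} (f : L.obj X ⟶ P) (g : L.obj Y ⟶ Q) :
    L.obj (X ⊕ Y) ⟶ P.sum Q :=
  ⟨PEmpty.elim, Sum.map (Hom.onPlaces f) (Hom.onPlaces g), fun τ => τ.elim, fun τ => τ.elim⟩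

/-- Associator for coproducts. -/
def sumAssoc (P Q K : Petri.{u}) : (P.sum Q).sum K ≅ P.sum (Q.sum K) where
  hom := sumDesc (sumDesc (sumInl _ _) (sumInl _ _ ≫ sumInr _ _)) (sumInr _ _ ≫ sumInr _ _)
  inv := sumDesc (sumInl _ _ ≫ sumInl _ _) (sumDesc (sumInr _ _ ≫ sumInl _ _) (sumInr _ _))
  hom_inv_id := hom_ext (by rintro ((τ | τ) | τ) <;> rfl) (by rintro ((τ | τ) | τ) <;> rfl)
  inv_hom_id := hom_ext (by rintro (τ | (τ | τ)) <;> rfl) (by rintro (τ | (τ | τ)) <;> rfl)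

/-- The morphism from the empty Petri net. -/
def emptyDesc (P : Petri.{u}) : L.obj PEmpty ⟶ P :=
  ⟨PEmpty.elim, PEmpty.elim, fun τ => τ.elim, fun τ => τ.elim⟩

/-- Left unitor for coproducts. -/
def sumLeft (P : Petri.{u}) : (L.obj PEmpty).sum P ≅ P where
  hom := sumDesc (emptyDesc P) (𝟙 P)
  inv := sumInr _ _
  hom_inv_id := hom_ext (by rintro (τ | τ); exacts [τ.elim, rfl])
    (by rintro (τ | τ); exacts [τ.elim, rfl])
  inv_hom_id := rfl

/-- Right unitor for coproducts. -/
def sumRight (P : Petri.{u}) : P.sum (L.obj PEmpty) ≅ P where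
  hom := sumDesc (𝟙 P) (emptyDesc P)
  inv := sumInl _ _
  hom_inv_id := hom_ext (by rintro (τ | τ); exacts [rfl, τ.elim])
    (by rintro (τ | τ); exacts [rfl, τ.elim])
  inv_hom_id := rfl

/-- The symmetry for coproducts. -/
def sumComm (P Q : Petri.{u}) : P.sum Q ≅ Q.sum P where
  hom := sumDesc (sumInr _ _) (sumInl _ _)
  inv := sumDesc (sumInr _ _) (sumInl _ _)
  hom_inv_id := hom_ext (by rintro (τ | τ) <;> rfl) (by rintro (τ | τ) <;> rfl)
  inv_hom_id := hom_ext (by rintro (τ | τ) <;> rfl) (by rintro (τ | τ) <;> rfl)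

/-- `L` preserves binary coproducts. -/
def LSum (X Y : Type u) : L.obj (X ⊕ Y) ≅ (L.obj X).sum (L.obj Y) where
  hom := sumL (𝟙 _) (𝟙 _)
  inv := sumDesc (L.map (↾Sum.inl)) (L.map (↾Sum.inr))
  hom_inv_id := hom_ext (fun τ => τ.elim) (by rintro (x | x) <;> rfl)
  inv_hom_id := hom_ext (by rintro (τ | τ) <;> exact τ.elim) (by rintro (x | x) <;> rfl)

/-- Associator for pushouts. -/
def glueAssoc {X Y : Type u} {P Q K : Petri.{u}} (o : L.obj X ⟶ P) (i : L.obj X ⟶ Q)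
    (o' : L.obj Y ⟶ Q) (i' : L.obj Y ⟶ K) :
    glue o (i ≫ glueInl o' i') ≅ glue (o' ≫ glueInr o i) i' where
  hom := glueDesc (glueInl _ _ ≫ glueInl _ _)
    (glueDesc (glueInr _ _ ≫ glueInl _ _) (glueInr _ _) (glue_condition (o' ≫ glueInr o i) i'))
    (congrArg (· ≫ glueInl (o' ≫ glueInr o i) i') (glue_condition o i))
  inv := glueDesc
    (glueDesc (glueInl _ _) (glueInl _ _ ≫ glueInr _ _) (glue_condition o (i ≫ glueInl o' i')))
    (glueInr _ _ ≫ glueInr _ _)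
    (congrArg (· ≫ glueInr o (i ≫ glueInl o' i')) (glue_condition o' i'))
  hom_inv_id := hom_ext (by rintro (τ | τ | τ) <;> rfl) (by rintro ⟨p | q⟩ <;> [rfl; (rcases q with ⟨p | p⟩ <;> rfl)])
  inv_hom_id := hom_ext (by rintro ((τ | τ) | τ) <;> rfl) (by rintro ⟨q | p⟩ <;> [(rcases q with ⟨p | p⟩ <;> rfl); rfl])

/-- Left unitor for pushouts. -/
def glueLeft {X : Type u} {P : Petri.{u}} (o : L.obj X ⟶ P) : glue o (𝟙 (L.obj X)) ≅ P where
  hom := glueDesc (𝟙 P) o rfl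
  inv := glueInl _ _
  hom_inv_id := hom_ext (by rintro (τ | τ); exacts [rfl, τ.elim]) (by
    rintro ⟨p | x⟩
    · rfl
    · exact Quot.sound ⟨x, rfl, rfl⟩)
  inv_hom_id := rfl

/-- Right unitor for pushouts. -/
def glueRight {X : Type u} {P : Petri.{u}} (i : L.obj X ⟶ P) : glue (𝟙 (L.obj X)) i ≅ P where
  hom := glueDesc i (𝟙 P) rfl
  inv := glueInr _ _
  hom_inv_id := hom_ext (by rintro (τ | τ); exacts [τ.elim, rfl]) (by
    rintro ⟨x | p⟩
    · exact (Quot.sound ⟨x, rfl, rfl⟩).symm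
    · rfl)
  inv_hom_id := rfl

/-- Pushouts commute with coproducts. -/
def glueSum {X X' : Type u} {P Q P' Q' : Petri.{u}} (o : L.obj X ⟶ P) (i : L.obj X ⟶ Q)
    (o' : L.obj X' ⟶ P') (i' : L.obj X' ⟶ Q') :
    glue (sumL o o') (sumL i i') ≅ (glue o i).sum (glue o' i') where
  hom := glueDesc (sumMap (glueInl o i) (glueInl o' i')) (sumMap (glueInr o i) (glueInr o' i'))
    (hom_ext (fun τ => τ.elim) (by
      rintro (x | x)
      · exact congrArg Sum.inl (Quot.sound ⟨x, rfl, rfl⟩)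
      · exact congrArg Sum.inr (Quot.sound ⟨x, rfl, rfl⟩)))
  inv := sumDesc
    (glueDesc (sumInl P P' ≫ glueInl (sumL o o') (sumL i i'))
      (sumInl Q Q' ≫ glueInr (sumL o o') (sumL i i'))
      (hom_ext (fun τ => τ.elim) fun x => Quot.sound ⟨Sum.inl x, rfl, rfl⟩))
    (glueDesc (sumInr P P' ≫ glueInl (sumL o o') (sumL i i'))
      (sumInr Q Q' ≫ glueInr (sumL o o') (sumL i i'))
      (hom_ext (fun τ => τ.elim) fun x => Quot.sound ⟨Sum.inr x, rfl, rfl⟩))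
  hom_inv_id := hom_ext (by rintro ((τ | τ) | (τ | τ)) <;> rfl)
    (by rintro ⟨(p | p) | (p | p)⟩ <;> rfl)
  inv_hom_id := hom_ext (by rintro ((τ | τ) | (τ | τ)) <;> rfl)
    (by rintro (q | q) <;> rcases q with ⟨p | p⟩ <;> rfl)

end Petri

/-- The chosen coproducts of sets, as a monoidal structure. -/
abbrev sumMonoidal : MonoidalCategory (Type u) where
  tensorObj X Y := X ⊕ Y
  whiskerLeft _ _ _ f := ↾(Sum.map id f)
  whiskerRight f _ := ↾(Sum.map f id)
  tensorHom f g := ↾(Sum.map f g)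
  tensorUnit := PEmpty
  associator X Y Z := (Equiv.sumAssoc X Y Z).toIso
  leftUnitor X := (Equiv.emptySum PEmpty X).toIso
  rightUnitor X := (Equiv.sumEmpty X PEmpty).toIso
  tensorHom_def _ _ := by ext (x | x) <;> rfl
  id_tensorHom_id _ _ := by ext (x | x) <;> rfl
  tensorHom_comp_tensorHom _ _ _ _ := by ext (x | x) <;> rfl
  whiskerLeft_id _ _ := by ext (x | x) <;> rfl
  id_whiskerRight _ _ := by ext (x | x) <;> rfl
  associator_naturality _ _ _ := by ext ((x | x) | x) <;> rfl
  leftUnitor_naturality _ := by ext (x | x); exacts [x.elim, rfl]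
  rightUnitor_naturality _ := by ext (x | x); exacts [rfl, x.elim]
  pentagon _ _ _ _ := by ext (((x | x) | x) | x) <;> rfl
  triangle _ _ := by ext ((x | x) | x); exacts [rfl, x.elim, rfl]

/-- The symmetry of the chosen coproducts of sets. -/
abbrev sumSymmetric : @SymmetricCategory (Type u) _ sumMonoidal :=
  letI := sumMonoidal.{u}
  { braiding := fun X Y => (Equiv.sumComm X Y).toIso
    braiding_naturality_right := fun _ _ _ _ => by ext (x | x) <;> rfl
    braiding_naturality_left := fun _ _ => by ext (x | x) <;> rfl
    hexagon_forward := fun _ _ _ => by ext ((x | x) | x) <;> rfl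
    hexagon_reverse := fun _ _ _ => by ext (x | (x | x)) <;> rfl
    symmetry := fun _ _ => by ext (x | x) <;> rfl }

namespace OpenPetri

/-- The tensor product of open Petri nets: disjoint union. -/
def tensor {X Y X' Y' : Type u} (P : OpenPetri X Y) (Q : OpenPetri X' Y') :
    OpenPetri (X ⊕ X') (Y ⊕ Y') :=
  ⟨P.apex.sum Q.apex, Petri.sumL P.inp Q.inp, Petri.sumL P.out Q.out⟩

/-- The tensor product of 2-morphisms. -/
def tensorMap {P Q P' Q' : HCell OpenPetri.{u}} (α : P ⟶ P') (β : Q ⟶ Q') :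
    (HCell.mk (P.src ⊕ Q.src) (P.tgt ⊕ Q.tgt) (tensor P.cell Q.cell) : HCell OpenPetri.{u}) ⟶
      HCell.mk (P'.src ⊕ Q'.src) (P'.tgt ⊕ Q'.tgt) (tensor P'.cell Q'.cell) where
  left := ↾(Sum.map (OpenPetriSquare.left α) (OpenPetriSquare.left β))
  right := ↾(Sum.map (OpenPetriSquare.right α) (OpenPetriSquare.right β))
  apex := Petri.sumMap (OpenPetriSquare.apex α) (OpenPetriSquare.apex β)
  inp_comm := Petri.hom_ext (fun τ => τ.elim) (by
    rintro (x | x)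
    · exact congrArg Sum.inl
        (congrFun (congrArg Petri.Hom.onPlaces (OpenPetriSquare.inp_comm α)) x)
    · exact congrArg Sum.inr
        (congrFun (congrArg Petri.Hom.onPlaces (OpenPetriSquare.inp_comm β)) x))
  out_comm := Petri.hom_ext (fun τ => τ.elim) (by
    rintro (x | x)
    · exact congrArg Sum.inl
        (congrFun (congrArg Petri.Hom.onPlaces (OpenPetriSquare.out_comm α)) x)
    · exact congrArg Sum.inr
        (congrFun (congrArg Petri.Hom.onPlaces (OpenPetriSquare.out_comm β)) x))

end OpenPetri

open OpenPetriSquare in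
/-- The symmetric monoidal double category of open Petri nets.  Objects are sets, vertical
1-morphisms are functions, horizontal 1-cells are open Petri nets composed by pushout, 2-morphisms are
commuting diagrams, and the tensor product is given by coproducts of sets and of Petri nets. -/
def OpenPetriDouble : SymmetricMonoidalDoubleCategory.{u + 1, u, u + 1, u} where
  Obj := Type u
  Hor := OpenPetri
  srcMap α := OpenPetriSquare.left α
  tgtMap α := OpenPetriSquare.right α
  srcMap_id _ := rfl
  tgtMap_id _ := rfl
  srcMap_comp _ _ := rfl
  tgtMap_comp _ _ := rfl
  unit X := OpenPetri.unit X
  unitMap f := ⟨f, f, Petri.L.map f, rfl, rfl⟩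
  srcMap_unitMap _ := rfl
  tgtMap_unitMap _ := rfl
  unitMap_id _ := rfl
  unitMap_comp _ _ := rfl
  comp N M := OpenPetri.comp N M
  compMap β α h := OpenPetri.compMap β α h
  srcMap_compMap _ _ _ := rfl
  tgtMap_compMap _ _ _ := rfl
  compMap_id _ _ := hom_ext (fun _ => rfl) (fun _ => rfl) (by rintro (τ | τ) <;> rfl)
    (by rintro ⟨p | p⟩ <;> rfl)
  compMap_comp _ _ _ _ _ _ := hom_ext (fun _ => rfl) (fun _ => rfl) (by rintro (τ | τ) <;> rfl)
    (by rintro ⟨p | p⟩ <;> rfl)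
  assoc N N' N'' := OpenPetriSquare.iso (Iso.refl _) (Iso.refl _)
    (Petri.glueAssoc N''.out N'.inp N'.out N.inp) rfl rfl
  srcMap_assoc _ _ _ := rfl
  tgtMap_assoc _ _ _ := rfl
  assoc_naturality _ _ _ _ _ := hom_ext (fun _ => rfl) (fun _ => rfl)
    (by rintro (τ | (τ | τ)) <;> rfl) (by rintro ⟨p | q⟩ <;> [rfl; (rcases q with ⟨p | p⟩ <;> rfl)])
  leftUnitor N := OpenPetriSquare.iso (Iso.refl _) (Iso.refl _) (Petri.glueLeft N.out) rfl rfl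
  srcMap_leftUnitor _ := rfl
  tgtMap_leftUnitor _ := rfl
  leftUnitor_naturality α := hom_ext (fun _ => rfl) (fun _ => rfl)
    (by rintro (τ | τ); exacts [rfl, τ.elim])
    (by
      rintro ⟨p | p⟩
      · rfl
      · exact (congrFun (congrArg Petri.Hom.onPlaces (OpenPetriSquare.out_comm α)) p).symm)
  rightUnitor N := OpenPetriSquare.iso (Iso.refl _) (Iso.refl _) (Petri.glueRight N.inp) rfl rfl
  srcMap_rightUnitor _ := rfl
  tgtMap_rightUnitor _ := rfl
  rightUnitor_naturality α := hom_ext (fun _ => rfl) (fun _ => rfl)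
    (by rintro (τ | τ); exacts [τ.elim, rfl])
    (by
      rintro ⟨p | p⟩
      · exact (congrFun (congrArg Petri.Hom.onPlaces (OpenPetriSquare.inp_comm α)) p).symm
      · rfl)
  pentagon _ _ _ _ := hom_ext (fun _ => rfl) (fun _ => rfl)
    (by rintro (τ | (τ | (τ | τ))) <;> rfl) (by
      rintro ⟨p | q⟩ <;> [rfl; rcases q with ⟨p | q⟩] <;> [rfl; (rcases q with ⟨p | p⟩ <;> rfl)])
  triangle _ _ := hom_ext (fun _ => rfl) (fun _ => rfl)
    (by rintro (τ | (τ | τ)); exacts [rfl, τ.elim, rfl])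
    (by
      rintro ⟨p | q⟩
      · rfl
      · rcases q with ⟨p | p⟩
        · exact Quot.sound ⟨p, rfl, rfl⟩
        · rfl)
  monObj := sumMonoidal
  symmObj := sumSymmetric
  tensor P Q := OpenPetri.tensor P Q
  tensorMap α β := OpenPetri.tensorMap α β
  srcMap_tensorMap _ _ := rfl
  tgtMap_tensorMap _ _ := rfl
  tensorMap_id _ _ := hom_ext (by rintro (x | x) <;> rfl) (by rintro (x | x) <;> rfl)
    (by rintro (τ | τ) <;> rfl) (by rintro (p | p) <;> rfl)
  tensorMap_comp _ _ _ _ := hom_ext (by rintro (x | x) <;> rfl) (by rintro (x | x) <;> rfl)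
    (by rintro (τ | τ) <;> rfl) (by rintro (p | p) <;> rfl)
  tensorAssoc {A B A' B' A'' B''} P Q K := OpenPetriSquare.iso (Equiv.sumAssoc A A' A'').toIso
    (Equiv.sumAssoc B B' B'').toIso (Petri.sumAssoc P.apex Q.apex K.apex)
    (Petri.hom_ext (fun τ => τ.elim) (by rintro ((x | x) | x) <;> rfl))
    (Petri.hom_ext (fun τ => τ.elim) (by rintro ((x | x) | x) <;> rfl))
  srcMap_tensorAssoc _ _ _ := rfl
  tgtMap_tensorAssoc _ _ _ := rfl
  tensorAssoc_naturality _ _ _ := hom_ext (by rintro ((x | x) | x) <;> rfl)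
    (by rintro ((x | x) | x) <;> rfl) (by rintro ((τ | τ) | τ) <;> rfl)
    (by rintro ((p | p) | p) <;> rfl)
  tensorLeft {A B} P := OpenPetriSquare.iso (Equiv.emptySum PEmpty A).toIso
    (Equiv.emptySum PEmpty B).toIso (Petri.sumLeft P.apex)
    (Petri.hom_ext (fun τ => τ.elim) (by rintro (x | x); exacts [x.elim, rfl]))
    (Petri.hom_ext (fun τ => τ.elim) (by rintro (x | x); exacts [x.elim, rfl]))
  srcMap_tensorLeft _ := rfl
  tgtMap_tensorLeft _ := rfl
  tensorLeft_naturality _ := hom_ext (by rintro (x | x); exacts [x.elim, rfl])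
    (by rintro (x | x); exacts [x.elim, rfl]) (by rintro (x | x); exacts [x.elim, rfl])
    (by rintro (x | x); exacts [x.elim, rfl])
  tensorRight {A B} P := OpenPetriSquare.iso (Equiv.sumEmpty A PEmpty).toIso
    (Equiv.sumEmpty B PEmpty).toIso (Petri.sumRight P.apex)
    (Petri.hom_ext (fun τ => τ.elim) (by rintro (x | x); exacts [rfl, x.elim]))
    (Petri.hom_ext (fun τ => τ.elim) (by rintro (x | x); exacts [rfl, x.elim]))
  srcMap_tensorRight _ := rfl
  tgtMap_tensorRight _ := rfl
  tensorRight_naturality _ := hom_ext (by rintro (x | x); exacts [rfl, x.elim])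
    (by rintro (x | x); exacts [rfl, x.elim]) (by rintro (x | x); exacts [rfl, x.elim])
    (by rintro (x | x); exacts [rfl, x.elim])
  tensorBraiding {A B A' B'} P Q := OpenPetriSquare.iso (Equiv.sumComm A A').toIso
    (Equiv.sumComm B B').toIso (Petri.sumComm P.apex Q.apex)
    (Petri.hom_ext (fun τ => τ.elim) (by rintro (x | x) <;> rfl))
    (Petri.hom_ext (fun τ => τ.elim) (by rintro (x | x) <;> rfl))
  srcMap_tensorBraiding _ _ := rfl
  tgtMap_tensorBraiding _ _ := rfl
  tensorBraiding_naturality _ _ := hom_ext (by rintro (x | x) <;> rfl) (by rintro (x | x) <;> rfl)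
    (by rintro (τ | τ) <;> rfl) (by rintro (p | p) <;> rfl)
  tensor_pentagon _ _ _ _ := hom_ext (by rintro (((x | x) | x) | x) <;> rfl)
    (by rintro (((x | x) | x) | x) <;> rfl) (by rintro (((x | x) | x) | x) <;> rfl)
    (by rintro (((x | x) | x) | x) <;> rfl)
  tensor_triangle _ _ := hom_ext (by rintro ((x | x) | x); exacts [rfl, x.elim, rfl])
    (by rintro ((x | x) | x); exacts [rfl, x.elim, rfl])
    (by rintro ((x | x) | x); exacts [rfl, x.elim, rfl])
    (by rintro ((x | x) | x); exacts [rfl, x.elim, rfl])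
  tensor_hexagon _ _ _ := hom_ext (by rintro ((x | x) | x) <;> rfl)
    (by rintro ((x | x) | x) <;> rfl) (by rintro ((x | x) | x) <;> rfl)
    (by rintro ((x | x) | x) <;> rfl)
  tensor_hexagon_reverse _ _ _ := hom_ext (by rintro (x | (x | x)) <;> rfl)
    (by rintro (x | (x | x)) <;> rfl) (by rintro (x | (x | x)) <;> rfl)
    (by rintro (x | (x | x)) <;> rfl)
  tensor_symmetry _ _ := hom_ext (by rintro (x | x) <;> rfl) (by rintro (x | x) <;> rfl)
    (by rintro (x | x) <;> rfl) (by rintro (x | x) <;> rfl)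
  χ M₁ N₁ M₂ N₂ := OpenPetriSquare.iso (Iso.refl _) (Iso.refl _)
    (Petri.glueSum M₂.out M₁.inp N₂.out N₁.inp)
    (Petri.hom_ext (fun τ => τ.elim) (by rintro (x | x) <;> rfl))
    (Petri.hom_ext (fun τ => τ.elim) (by rintro (x | x) <;> rfl))
  srcMap_χ _ _ _ _ := rfl
  tgtMap_χ _ _ _ _ := rfl
  χ_naturality _ _ _ _ _ _ := hom_ext (fun _ => rfl) (fun _ => rfl)
    (by rintro ((τ | τ) | (τ | τ)) <;> rfl) (by rintro ⟨(p | p) | (p | p)⟩ <;> rfl)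
  μ A B := OpenPetriSquare.iso (Iso.refl _) (Iso.refl _) (Petri.LSum A B) rfl rfl
  srcMap_μ _ _ := rfl
  tgtMap_μ _ _ := rfl
  μ_naturality _ _ := hom_ext (fun _ => rfl) (fun _ => rfl) (fun τ => τ.elim)
    (by rintro (p | p) <;> rfl)
  χ_assoc _ _ _ _ _ _ := hom_ext (by rintro (x | x) <;> rfl) (by rintro (x | x) <;> rfl)
    (by rintro ((τ | τ) | ((τ | τ) | (τ | τ))) <;> rfl)
    (by
      rintro ⟨(p | p) | q⟩ <;> [rfl; rfl; (rcases q with ⟨(p | p) | (p | p)⟩ <;> rfl)])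
  χ_rightUnitor _ _ := hom_ext (by rintro (x | x) <;> rfl) (by rintro (x | x) <;> rfl)
    (by rintro (τ | (τ | τ)); exacts [τ.elim, rfl, rfl])
    (by rintro ⟨(p | p) | (p | p)⟩ <;> rfl)
  χ_leftUnitor _ _ := hom_ext (by rintro (x | x) <;> rfl) (by rintro (x | x) <;> rfl)
    (by rintro ((τ | τ) | τ); exacts [rfl, rfl, τ.elim])
    (by rintro ⟨(p | p) | (p | p)⟩ <;> rfl)
  tensorAssoc_χ _ _ _ _ _ _ := hom_ext (by rintro ((x | x) | x) <;> rfl)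
    (by rintro ((x | x) | x) <;> rfl)
    (by rintro (((τ | τ) | τ) | ((τ | τ) | τ)) <;> rfl)
    (by rintro ⟨((p | p) | p) | ((p | p) | p)⟩ <;> rfl)
  tensorAssoc_μ _ _ _ := hom_ext (by rintro ((x | x) | x) <;> rfl)
    (by rintro ((x | x) | x) <;> rfl) (fun τ => τ.elim) (by rintro ((x | x) | x) <;> rfl)
  tensorLeft_χ _ _ := hom_ext (by rintro (x | x); exacts [x.elim, rfl])
    (by rintro (x | x); exacts [x.elim, rfl])
    (by rintro ((x | x) | (x | x)); exacts [x.elim, rfl, x.elim, rfl])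
    (by rintro ⟨(x | x) | (x | x)⟩; exacts [x.elim, rfl, x.elim, rfl])
  tensorLeft_μ _ := hom_ext (by rintro (x | x); exacts [x.elim, rfl])
    (by rintro (x | x); exacts [x.elim, rfl]) (fun τ => τ.elim)
    (by rintro (x | x); exacts [x.elim, rfl])
  tensorRight_χ _ _ := hom_ext (by rintro (x | x); exacts [rfl, x.elim])
    (by rintro (x | x); exacts [rfl, x.elim])
    (by rintro ((x | x) | (x | x)); exacts [rfl, x.elim, rfl, x.elim])
    (by rintro ⟨(x | x) | (x | x)⟩; exacts [rfl, x.elim, rfl, x.elim])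
  tensorRight_μ _ := hom_ext (by rintro (x | x); exacts [rfl, x.elim])
    (by rintro (x | x); exacts [rfl, x.elim]) (fun τ => τ.elim)
    (by rintro (x | x); exacts [rfl, x.elim])
  tensorBraiding_χ _ _ _ _ := hom_ext (by rintro (x | x) <;> rfl) (by rintro (x | x) <;> rfl)
    (by rintro ((τ | τ) | (τ | τ)) <;> rfl) (by rintro ⟨(p | p) | (p | p)⟩ <;> rfl)
  tensorBraiding_μ _ _ := hom_ext (by rintro (x | x) <;> rfl) (by rintro (x | x) <;> rfl)
    (fun τ => τ.elim) (by rintro (p | p) <;> rfl)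

/-! ## The reachability semantics -/

namespace Petri

/-- `(τ, m, n)` is a firing of the transition `τ`. -/
def IsFiring (P : Petri.{u}) (τ : P.trans) (m n : Multiset P.places) : Prop :=
  P.source τ ≤ m ∧ n + P.source τ = m + P.target τ

/-- The marking `n` is reachable from the marking `m`: there is a finite, possibly empty, sequence
of firings leading from `m` to `n`. -/
def Reachable (P : Petri.{u}) : Multiset P.places → Multiset P.places → Prop :=
  Relation.ReflTransGen fun m n => ∃ τ, P.IsFiring τ m n

/-- Morphisms of Petri nets preserve reachability. -/
theorem Reachable.map {P Q : Petri.{u}} (f : P ⟶ Q) {m n : Multiset P.places}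
    (h : P.Reachable m n) :
    Q.Reachable (m.map (Hom.onPlaces f)) (n.map (Hom.onPlaces f)) := by
  unfold Reachable at h ⊢
  refine Relation.ReflTransGen.lift (Multiset.map (Hom.onPlaces f)) ?_ _ _ h
  rintro a b ⟨τ, h₁, h₂⟩
  refine ⟨Hom.onTrans f τ, ?_, ?_⟩
  · rw [← Hom.source_comm f]
    exact Multiset.map_le_map h₁
  · rw [← Hom.source_comm f, ← Hom.target_comm f, ← Multiset.map_add, h₂, Multiset.map_add]

end Petri

/-- The reachability relation `■P ⊆ ℕ[X] × ℕ[Y]` of an open Petri net `P` from `X` to `Y`. -/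
def OpenPetri.reachability {X Y : Type u} (P : OpenPetri X Y) : Set (Multiset X × Multiset Y) :=
  {p | P.apex.Reachable (p.1.map (Petri.Hom.onPlaces P.inp)) (p.2.map (Petri.Hom.onPlaces P.out))}

/-- A 2-morphism of open Petri nets from `f` to `g` induces `(ℕ[f] × ℕ[g]) ■P ⊆ ■Q`. -/
theorem OpenPetriSquare.reachability_map {P Q : HCell OpenPetri.{u}} (α : OpenPetriSquare P Q)
    (x : Multiset P.src) (y : Multiset P.tgt) (h : (x, y) ∈ P.cell.reachability) :
    (x.map α.left, y.map α.right) ∈ Q.cell.reachability := by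
  have h₁ : Petri.Hom.onPlaces α.apex ∘ Petri.Hom.onPlaces P.cell.inp =
      Petri.Hom.onPlaces Q.cell.inp ∘ α.left := congrArg Petri.Hom.onPlaces α.inp_comm
  have h₂ : Petri.Hom.onPlaces α.apex ∘ Petri.Hom.onPlaces P.cell.out =
      Petri.Hom.onPlaces Q.cell.out ∘ α.right := congrArg Petri.Hom.onPlaces α.out_comm
  have e₁ := (Multiset.map_map _ _ _).trans
    ((congrArg (fun g => Multiset.map g x) h₁).trans (Multiset.map_map _ _ _).symm)
  have e₂ := (Multiset.map_map _ _ _).trans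
    ((congrArg (fun g => Multiset.map g y) h₂).trans (Multiset.map_map _ _ _).symm)
  exact Eq.mp (congrArg₂ Q.cell.apex.Reachable e₁ e₂) (Petri.Reachable.map α.apex h)

/-- The reachability semantics `■` on objects, vertical 1-morphisms, horizontal 1-cells and
2-morphisms: it sends `X` to `ℕ[X]`, `f` to `ℕ[f]`, an open Petri net to its reachability relation,
and a 2-morphism from `f` to `g` to the square with sides `ℕ[f]` and `ℕ[g]`. -/
def reachabilitySemantics :
    DoubleFunctorData OpenPetriDouble.{u}.toDoubleCategory RelDouble.{u}.toDoubleCategory where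
  F₀ := markingFunctor
  hor P := OpenPetri.reachability P
  sq α := ⟨markingFunctor.map (OpenPetriSquare.left α), markingFunctor.map (OpenPetriSquare.right α),
    OpenPetriSquare.reachability_map α⟩
  srcMap_sq _ := rfl
  tgtMap_sq _ := rfl
  sq_id _ := RelSquare.hom_ext (markingFunctor.map_id _) (markingFunctor.map_id _)
  sq_comp _ _ := RelSquare.hom_ext (markingFunctor.map_comp _ _) (markingFunctor.map_comp _ _)

/-! Two facts about token games carry the theorem. The first is locality: a firing needs only the
tokens it consumes, so reachability is stable under adding spectator tokens
(`Petri.Reachable.add_right`), and it is preserved by morphisms of nets. The second is independence: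
in `P + Q` a marking splits uniquely into a marking of `P` and one of `Q` (`Multiset.sumEquiv`), and
every transition belongs to one summand and leaves the other component alone. A firing sequence in
`P + Q` is therefore an interleaving of a sequence in `P` with one in `Q`, and any two such
sequences can be run one after the other; this is `Petri.reachable_sum_iff`, hence
`OpenPetri.mem_reachability_tensor_iff`.

The composition comparison holds because a run of `P` from `x` to `y` and a run of `Q` from `y` to
`z` can be pushed into the pushout, where the two images of `y` coincide
(`OpenPetri.mem_reachability_comp`). It is only an inclusion: a composite net may pass tokens back
and forth across the shared places. The identity comparison holds because a net without transitions
reaches nothing new.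

No coherence law requires further reasoning about firings. A 2-morphism of relations is determined
by its two vertical sides, so each equation of squares is a pair of equations between functions. For
the lax structure these follow from functoriality of `markingFunctor`; for the monoidal structure on
arrows they are the laws of the monoidal structure on objects, read once at sources and once at
targets. What remains is that `Multiset.sumEquiv` is natural and respects the associators, unitors
and symmetries of coproducts. -/

/-! ## Multisets in a disjoint union -/

namespace Multiset

/-- A multiset in `X ⊕ Y` is a pair of a multiset in `X` and a multiset in `Y`. -/
def sumEquiv (X Y : Type*) : Multiset X × Multiset Y ≃ Multiset (X ⊕ Y) where
  toFun p := p.1.map Sum.inl + p.2.map Sum.inr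
  invFun m := (m.filterMap Sum.getLeft?, m.filterMap Sum.getRight?)
  left_inv p := by
    -- Each of the two filters keeps its own summand unchanged (`h₁`, `h₂`) and kills the other one
    -- (`h₃`, `h₄`).
    have h₁ : ∀ s : Multiset X, (s.map (Sum.inl : X → X ⊕ Y)).filterMap Sum.getLeft? = s :=
      fun s => (filterMap_map _ _ s).trans (filterMap_some s)
    have h₂ : ∀ s : Multiset Y, (s.map (Sum.inr : Y → X ⊕ Y)).filterMap Sum.getRight? = s :=
      fun s => (filterMap_map _ _ s).trans (filterMap_some s)
    have h₃ : ∀ s : Multiset Y, (s.map (Sum.inr : Y → X ⊕ Y)).filterMap Sum.getLeft? = 0 := by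
      intro s
      induction s using Multiset.induction_on with
      | empty => rfl
      | cons a s ih => rw [map_cons, filterMap_cons_none _ _ rfl, ih]
    have h₄ : ∀ s : Multiset X, (s.map (Sum.inl : X → X ⊕ Y)).filterMap Sum.getRight? = 0 := by
      intro s
      induction s using Multiset.induction_on with
      | empty => rfl
      | cons a s ih => rw [map_cons, filterMap_cons_none _ _ rfl, ih]
    simp only [filterMap_add, h₁, h₂, h₃, h₄, add_zero, zero_add]
  right_inv m := by
    induction m using Multiset.induction_on with
    | empty => rfl
    | cons a s ih =>
      -- A new element is kept by exactly one of the two filters, so it is put back into exactly one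
      -- of the two summands.
      rcases a with a | a
      · dsimp only at ih ⊢
        rw [filterMap_cons_some Sum.getLeft? (Sum.inl a) s (b := a) rfl,
          filterMap_cons_none (f := Sum.getRight?) (Sum.inl a) s rfl, map_cons, cons_add, ih]
      · dsimp only at ih ⊢
        rw [filterMap_cons_none (f := Sum.getLeft?) (Sum.inr a) s rfl,
          filterMap_cons_some Sum.getRight? (Sum.inr a) s (b := a) rfl, map_cons, add_cons, ih]

/-- The splitting is an isomorphism of monoids, which is what lets the firing condition, an
inequality and an equation between sums, be checked one component at a time. -/
theorem sumEquiv_add {X Y : Type*} (p q : Multiset X × Multiset Y) :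
    sumEquiv X Y (p + q) = sumEquiv X Y p + sumEquiv X Y q := by
  simp only [sumEquiv, Equiv.coe_fn_mk, Prod.fst_add, Prod.snd_add, map_add]
  abel

/-- The order on multisets is divisibility for addition, so an isomorphism of monoids transports it
to the componentwise order. -/
theorem map_inl_add_map_inr_le {X Y : Type*} {a c : Multiset X} {b d : Multiset Y} :
    a.map Sum.inl + b.map Sum.inr ≤ c.map Sum.inl + d.map Sum.inr ↔ a ≤ c ∧ b ≤ d := by
  constructor
  · intro h
    obtain ⟨e, he⟩ := le_iff_exists_add.mp h
    -- The complement `e` splits too; injectivity then yields `c = a + e₁` and `d = b + e₂`.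
    obtain ⟨⟨e₁, e₂⟩, rfl⟩ := (sumEquiv X Y).surjective e
    have h' : sumEquiv X Y (c, d) = sumEquiv X Y ((a, b) + (e₁, e₂)) :=
      he.trans (sumEquiv_add (a, b) (e₁, e₂)).symm
    obtain ⟨rfl, rfl⟩ := Prod.mk.inj ((sumEquiv X Y).injective h')
    exact ⟨le_add_right _ _, le_add_right _ _⟩
  · rintro ⟨h, h'⟩
    exact add_le_add (map_le_map h) (map_le_map h')

theorem map_inl_add_map_inr_inj {X Y : Type*} {a c : Multiset X} {b d : Multiset Y} :
    a.map Sum.inl + b.map Sum.inr = c.map Sum.inl + d.map Sum.inr ↔ a = c ∧ b = d :=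
  ((sumEquiv X Y).apply_eq_iff_eq (x := (a, b)) (y := (c, d))).trans Prod.mk_inj

/-- Naturality of the splitting. The two variants below, with one function the identity, are the
naturality squares for whiskerings. -/
theorem map_sumMap {X Y X' Y' : Type*} (f : X → X') (g : Y → Y') (x : Multiset X)
    (y : Multiset Y) :
    (x.map Sum.inl + y.map Sum.inr).map (Sum.map f g) =
      (x.map f).map Sum.inl + (y.map g).map Sum.inr := by
  simp only [map_add, map_map, Function.comp_def, Sum.map_inl, Sum.map_inr]

theorem map_sumMap_id {X Y X' : Type*} (f : X → X') (x : Multiset X) (y : Multiset Y) :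
    (x.map Sum.inl + y.map Sum.inr).map (Sum.map f id) =
      (x.map f).map Sum.inl + y.map Sum.inr := by
  rw [map_sumMap, map_id]

theorem map_sumMap_id_left {X Y Y' : Type*} (g : Y → Y') (x : Multiset X) (y : Multiset Y) :
    (x.map Sum.inl + y.map Sum.inr).map (Sum.map id g) =
      x.map Sum.inl + (y.map g).map Sum.inr := by
  rw [map_sumMap, map_id]

/-- This lemma, the two on empty summands and `map_sumComm` are the coherence laws of the monoidal
structure on markings, evaluated at elements. -/
theorem map_sumAssoc {X Y Z : Type*} (x : Multiset X) (y : Multiset Y) (z : Multiset Z) :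
    ((x.map Sum.inl + y.map Sum.inr).map Sum.inl + z.map Sum.inr).map (Equiv.sumAssoc X Y Z) =
      x.map Sum.inl + (y.map Sum.inl + z.map Sum.inr).map Sum.inr := by
  simp only [map_add, map_map, Function.comp_def, add_assoc, Equiv.sumAssoc_apply_inl_inl,
    Equiv.sumAssoc_apply_inl_inr, Equiv.sumAssoc_apply_inr]

theorem map_emptySum {E X : Type*} [IsEmpty E] (x : Multiset X) :
    ((0 : Multiset E).map Sum.inl + x.map Sum.inr).map (Equiv.emptySum E X) = x := by
  rw [map_zero, zero_add, map_map]
  exact map_id x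

theorem map_sumEmpty {E X : Type*} [IsEmpty E] (x : Multiset X) :
    (x.map Sum.inl + (0 : Multiset E).map Sum.inr).map (Equiv.sumEmpty X E) = x := by
  rw [map_zero, add_zero, map_map]
  exact map_id x

theorem map_sumComm {X Y : Type*} (x : Multiset X) (y : Multiset Y) :
    (x.map Sum.inl + y.map Sum.inr).map (Equiv.sumComm X Y) = y.map Sum.inl + x.map Sum.inr := by
  rw [map_add, map_map, map_map, add_comm]
  rfl

end Multiset

/-! ## Reachability -/

namespace Petri

/-- Locality of firing: the tokens `k` take no part. Since `IsFiring` is phrased by sums and not by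
subtraction, `k` is simply added to both sides. -/
theorem IsFiring.add_right {P : Petri.{u}} {τ : P.trans} {m n : Multiset P.places}
    (h : P.IsFiring τ m n) (k : Multiset P.places) : P.IsFiring τ (m + k) (n + k) := by
  refine ⟨h.1.trans (Multiset.le_add_right _ _), ?_⟩
  rw [add_right_comm, h.2, add_right_comm]

theorem Reachable.add_right {P : Petri.{u}} {m n : Multiset P.places} (h : P.Reachable m n)
    (k : Multiset P.places) : P.Reachable (m + k) (n + k) :=
  Relation.ReflTransGen.lift (· + k) (fun _ _ ⟨τ, h⟩ => ⟨τ, h.add_right k⟩) _ _ h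

theorem Reachable.add {P : Petri.{u}} {m n m' n' : Multiset P.places} (h : P.Reachable m n)
    (h' : P.Reachable m' n') : P.Reachable (m + m') (n + n') := by
  -- The first sequence runs while `m'` stays idle, then the second runs while the result `n` stays
  -- idle.
  refine Relation.ReflTransGen.trans (h.add_right m') ?_
  rw [add_comm n, add_comm n]
  exact h'.add_right n

/-- In a Petri net without transitions, only the marking itself is reachable. -/
theorem Reachable.eq_of_isEmpty {P : Petri.{u}} [IsEmpty P.trans] {m n : Multiset P.places}
    (h : P.Reachable m n) : m = n := by
  induction h with
  | refl => rfl
  | tail _ h => exact isEmptyElim h.choose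

/-- Behind the identity comparison: the apex of an identity open net is `L.obj X`, which has no
transitions. -/
theorem reachable_L_iff {X : Type u} {m n : Multiset X} :
    (L.obj X).Reachable m n ↔ m = n := by
  have : IsEmpty (L.obj X).trans := inferInstanceAs (IsEmpty PEmpty)
  exact ⟨fun h => h.eq_of_isEmpty, fun h => h ▸ Relation.ReflTransGen.refl⟩

/-- A transition of `P` neither consumes nor produces tokens in `Q`: padding its source and target
by `0` turns the firing condition into two independent conditions, and the one on `Q` collapses to
`b = d`. -/
theorem isFiring_sum_inl_iff {P Q : Petri.{u}} {τ : P.trans} {a c : Multiset P.places}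
    {b d : Multiset Q.places} :
    (P.sum Q).IsFiring (Sum.inl τ) (a.map Sum.inl + b.map Sum.inr)
      (c.map Sum.inl + d.map Sum.inr) ↔ P.IsFiring τ a c ∧ b = d := by
  have h₁ : (P.sum Q).source (Sum.inl τ) =
    (P.source τ).map Sum.inl + (0 : Multiset Q.places).map Sum.inr := (add_zero _).symm
  have h₂ : (P.sum Q).target (Sum.inl τ) =
    (P.target τ).map Sum.inl + (0 : Multiset Q.places).map Sum.inr := (add_zero _).symm
  -- Sums of split markings are regrouped by summand, so that the order and injectivity lemmas for
  -- split multisets apply.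
  have h₃ : ∀ (x x' : Multiset P.places) (y y' : Multiset Q.places),
      (x.map Sum.inl + y.map Sum.inr) + (x'.map Sum.inl + y'.map Sum.inr) =
        (x + x').map Sum.inl + (y + y').map Sum.inr :=
    fun x x' y y' => (Multiset.sumEquiv_add (x, y) (x', y')).symm
  unfold IsFiring
  rw [h₁, h₂]
  erw [h₃, h₃, Multiset.map_inl_add_map_inr_le, Multiset.map_inl_add_map_inr_inj]
  simp only [Multiset.zero_le, add_zero, and_true, and_assoc, eq_comm]

theorem isFiring_sum_inr_iff {P Q : Petri.{u}} {τ : Q.trans} {a c : Multiset P.places}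
    {b d : Multiset Q.places} :
    (P.sum Q).IsFiring (Sum.inr τ) (a.map Sum.inl + b.map Sum.inr)
      (c.map Sum.inl + d.map Sum.inr) ↔ a = c ∧ Q.IsFiring τ b d := by
  have h₁ : (P.sum Q).source (Sum.inr τ) =
    (0 : Multiset P.places).map Sum.inl + (Q.source τ).map Sum.inr := (zero_add _).symm
  have h₂ : (P.sum Q).target (Sum.inr τ) =
    (0 : Multiset P.places).map Sum.inl + (Q.target τ).map Sum.inr := (zero_add _).symm
  have h₃ : ∀ (x x' : Multiset P.places) (y y' : Multiset Q.places),
      (x.map Sum.inl + y.map Sum.inr) + (x'.map Sum.inl + y'.map Sum.inr) =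
        (x + x').map Sum.inl + (y + y').map Sum.inr :=
    fun x x' y y' => (Multiset.sumEquiv_add (x, y) (x', y')).symm
  unfold IsFiring
  rw [h₁, h₂]
  erw [h₃, h₃, Multiset.map_inl_add_map_inr_le, Multiset.map_inl_add_map_inr_inj]
  simp only [Multiset.zero_le, add_zero, true_and, eq_comm]
  tauto

/-- From left to right, a firing sequence is sorted into its firings in `P` and its firings in `Q`,
by induction on its length. From right to left, the two sequences are pushed along the coprojections
and run in succession. -/
theorem reachable_sum_iff {P Q : Petri.{u}} {a c : Multiset P.places} {b d : Multiset Q.places} :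
    (P.sum Q).Reachable (a.map Sum.inl + b.map Sum.inr) (c.map Sum.inl + d.map Sum.inr) ↔
      P.Reachable a c ∧ Q.Reachable b d := by
  constructor
  · intro h
    -- The endpoint varies along the induction, so its components `c` and `d` must vary as well.
    generalize hn : c.map Sum.inl + d.map Sum.inr = n at h
    induction h generalizing c d with
    | refl =>
      obtain ⟨rfl, rfl⟩ := Multiset.map_inl_add_map_inr_inj.mp hn
      exact ⟨Relation.ReflTransGen.refl, Relation.ReflTransGen.refl⟩
    | @tail k _ _ h ih =>
      subst hn
      -- The marking before the last firing splits as well; that firing extends just one of the two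
      -- sequences supplied by the induction hypothesis.
      obtain ⟨⟨k₁, k₂⟩, rfl⟩ := (Multiset.sumEquiv P.places Q.places).surjective k
      obtain ⟨h₁, h₂⟩ := ih rfl
      obtain ⟨τ | τ, h⟩ := h
      · obtain ⟨hτ, rfl⟩ := isFiring_sum_inl_iff.mp h
        exact ⟨h₁.tail ⟨τ, hτ⟩, h₂⟩
      · obtain ⟨rfl, hτ⟩ := isFiring_sum_inr_iff.mp h
        exact ⟨h₁, h₂.tail ⟨τ, hτ⟩⟩
  · rintro ⟨h, h'⟩
    exact Reachable.add (h.map (sumInl P Q)) (h'.map (sumInr P Q))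

end Petri

/-! ### Reachability relations of identities, disjoint unions and composites. -/

namespace OpenPetri

theorem mem_reachability_unit_iff {X : Type u} {x y : Multiset X} :
    (x, y) ∈ (OpenPetri.unit X).reachability ↔ x = y := by
  refine Iff.trans ?_ Petri.reachable_L_iff
  -- Both legs of the identity cospan act as the identity on places.
  exact Iff.of_eq (congrArg₂ _ (Multiset.map_id x) (Multiset.map_id y))

/-- The reachability relation of a disjoint union is the product of the reachability relations. -/
theorem mem_reachability_tensor_iff {X Y X' Y' : Type u} {P : OpenPetri X Y}
    {P' : OpenPetri X' Y'} {x : Multiset X} {x' : Multiset X'} {y : Multiset Y}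
    {y' : Multiset Y'} :
    (x.map Sum.inl + x'.map Sum.inr, y.map Sum.inl + y'.map Sum.inr) ∈
        (OpenPetri.tensor P P').reachability ↔
      (x, y) ∈ P.reachability ∧ (x', y') ∈ P'.reachability := by
  refine Iff.trans ?_ Petri.reachable_sum_iff
  exact Iff.of_eq (congrArg₂ _ (Multiset.map_sumMap _ _ x x') (Multiset.map_sumMap _ _ y y'))

/-- Both runs are carried into the pushout by its legs and concatenated there at the common image of
`y`. The converse fails in general, since a run of the composite may cross the boundary `Y` several
times in both directions. -/
theorem mem_reachability_comp {X Y Z : Type u} {Q : OpenPetri Y Z} {P : OpenPetri X Y}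
    {x : Multiset X} {y : Multiset Y} {z : Multiset Z} (h : (x, y) ∈ P.reachability)
    (h' : (y, z) ∈ Q.reachability) : (x, z) ∈ (OpenPetri.comp Q P).reachability := by
  have h₁ := Petri.Reachable.map (Petri.glueInl P.out Q.inp) h
  have h₂ := Petri.Reachable.map (Petri.glueInr P.out Q.inp) h'
  -- Commutativity of the pushout square makes the end of the first run the start of the second.
  have e : Petri.Hom.onPlaces (Petri.glueInl P.out Q.inp) ∘ Petri.Hom.onPlaces P.out =
      Petri.Hom.onPlaces (Petri.glueInr P.out Q.inp) ∘ Petri.Hom.onPlaces Q.inp :=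
    congrArg Petri.Hom.onPlaces (Petri.glue_condition P.out Q.inp)
  have e' := (Multiset.map_map _ _ y).trans
    ((congrArg (fun g => Multiset.map g y) e).trans (Multiset.map_map _ _ y).symm)
  have e₁ := Multiset.map_map (Petri.Hom.onPlaces (Petri.glueInl P.out Q.inp))
    (Petri.Hom.onPlaces P.inp) x
  have e₂ := Multiset.map_map (Petri.Hom.onPlaces (Petri.glueInr P.out Q.inp))
    (Petri.Hom.onPlaces Q.out) z
  have h₃ := Eq.mp (congrArg₂ (Petri.glue P.out Q.inp).Reachable e₁ e') h₁
  have h₄ := Eq.mp (congrArg ((Petri.glue P.out Q.inp).Reachable _) e₂) h₂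
  exact Relation.ReflTransGen.trans h₃ h₄

end OpenPetri

/-! ## The symmetric monoidal lax double functor -/

/-- The comparisons that make the reachability semantics a lax double functor. -/
def reachabilityLax : reachabilitySemantics.{u}.LaxStructure where
  φ _ _ := ⟨𝟙 _, 𝟙 _, fun _ _ ⟨_, h, h'⟩ => OpenPetri.mem_reachability_comp h h'⟩
  srcMap_φ _ _ := rfl
  tgtMap_φ _ _ := rfl
  φ_naturality _ _ _ := rfl
  φ₀ _ := ⟨𝟙 _, 𝟙 _, fun _ _ h => OpenPetri.mem_reachability_unit_iff.mpr h⟩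
  srcMap_φ₀ _ := rfl
  tgtMap_φ₀ _ := rfl
  φ₀_naturality _ := rfl
  -- The associators and unitors of open Petri nets have identity sides, so `■` sends them to
  -- squares with sides `ℕ[id]`; the equations reduce to `ℕ[id] = id`.
  φ_assoc _ _ _ := RelSquare.hom_ext (markingFunctor.map_id _) (markingFunctor.map_id _)
  φ_rightUnitor _ := RelSquare.hom_ext (markingFunctor.map_id _) (markingFunctor.map_id _)
  φ_leftUnitor _ := RelSquare.hom_ext (markingFunctor.map_id _) (markingFunctor.map_id _)

/-! ### Strong symmetric monoidal structures on objects and on arrows. -/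

/-- Functions that agree everywhere are equal as morphisms of sets. -/
theorem type_hom_ext {X Y : Type u} {f g : X ⟶ Y} (h : ∀ x, f x = g x) : f = g := by
  ext x
  exact h x

/-- The marking functor takes coproducts of sets to products. -/
@[reducible]
def markingCoreMonoidal :
    Functor.CoreMonoidal (C := OpenPetriDouble.{u}.Obj) (D := RelDouble.{u}.Obj)
      reachabilitySemantics.{u}.F₀ where
  εIso :=
    { hom := ↾fun _ => (0 : Multiset PEmpty)
      inv := ↾fun _ => PUnit.unit
      hom_inv_id := rfl
      inv_hom_id := by
        refine type_hom_ext fun m => ?_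
        -- The empty multiset is the only marking of the empty set, so `ℕ[∅]` is a one-point set.
        exact (Multiset.eq_zero_of_forall_notMem fun x => x.elim).symm }
  μIso X Y := (Multiset.sumEquiv X Y).toIso
  μIso_hom_natural_left _ _ := type_hom_ext fun ⟨x, y⟩ => (Multiset.map_sumMap_id _ x y).symm
  μIso_hom_natural_right _ _ := type_hom_ext fun ⟨x, y⟩ => (Multiset.map_sumMap_id_left _ x y).symm
  associativity _ _ _ := type_hom_ext fun ⟨⟨x, y⟩, z⟩ => Multiset.map_sumAssoc x y z
  left_unitality _ := type_hom_ext fun ⟨_, x⟩ => (Multiset.map_emptySum (E := PEmpty) x).symm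
  right_unitality _ := type_hom_ext fun ⟨x, _⟩ => (Multiset.map_sumEmpty (E := PEmpty) x).symm

/-- The marking functor is symmetric monoidal. -/
@[reducible]
def markingBraided :
    Functor.Braided (C := OpenPetriDouble.{u}.Obj) (D := RelDouble.{u}.Obj)
      reachabilitySemantics.{u}.F₀ where
  toMonoidal := markingCoreMonoidal.toMonoidal
  braided _ _ := type_hom_ext fun ⟨x, y⟩ => Multiset.map_sumComm x y

/-- The action of the reachability semantics on arrows takes coproducts of open Petri nets to
products of relations. -/
@[reducible]
def reachabilityCoreMonoidal : reachabilitySemantics.{u}.F₁.CoreMonoidal where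
  -- The sides of the structure squares are the structure maps on objects, so source and target are
  -- compatible with the monoidal structures by construction. Invertibility requires each relation
  -- to be carried into the other, in both directions.
  εIso := RelSquare.iso markingCoreMonoidal.εIso markingCoreMonoidal.εIso
    (fun _ _ _ => OpenPetri.mem_reachability_unit_iff.mpr rfl) (fun _ _ _ => rfl)
  μIso P Q := RelSquare.iso (markingCoreMonoidal.μIso P.src Q.src)
    (markingCoreMonoidal.μIso P.tgt Q.tgt)
    (fun _ _ h => OpenPetri.mem_reachability_tensor_iff.mpr h) (fun x y h => by
      -- The inverse square starts from arbitrary markings of the disjoint unions; they are written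
      -- in split form so that `OpenPetri.mem_reachability_tensor_iff` applies.
      obtain ⟨p, rfl⟩ := (Multiset.sumEquiv P.src Q.src).surjective x
      obtain ⟨q, rfl⟩ := (Multiset.sumEquiv P.tgt Q.tgt).surjective y
      have h' := OpenPetri.mem_reachability_tensor_iff.mp h
      have e₁ := (Multiset.sumEquiv P.src Q.src).symm_apply_apply p
      have e₂ := (Multiset.sumEquiv P.tgt Q.tgt).symm_apply_apply q
      change ((Multiset.sumEquiv P.src Q.src).symm _, (Multiset.sumEquiv P.tgt Q.tgt).symm _) ∈ _
      rw [e₁, e₂]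
      exact h')
  -- Each remaining law is an equation of squares, hence follows from the corresponding law on
  -- objects at the left and the right sides.
  μIso_hom_natural_left α Q := RelSquare.hom_ext
    (markingCoreMonoidal.μIso_hom_natural_left (OpenPetriSquare.left α) Q.src)
    (markingCoreMonoidal.μIso_hom_natural_left (OpenPetriSquare.right α) Q.tgt)
  μIso_hom_natural_right Q α := RelSquare.hom_ext
    (markingCoreMonoidal.μIso_hom_natural_right Q.src (OpenPetriSquare.left α))
    (markingCoreMonoidal.μIso_hom_natural_right Q.tgt (OpenPetriSquare.right α))
  associativity P Q K := RelSquare.hom_ext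
    (markingCoreMonoidal.associativity P.src Q.src K.src)
    (markingCoreMonoidal.associativity P.tgt Q.tgt K.tgt)
  left_unitality P := RelSquare.hom_ext
    (markingCoreMonoidal.left_unitality P.src) (markingCoreMonoidal.left_unitality P.tgt)
  right_unitality P := RelSquare.hom_ext
    (markingCoreMonoidal.right_unitality P.src) (markingCoreMonoidal.right_unitality P.tgt)

/-- The action of the reachability semantics on arrows is symmetric monoidal. -/
@[reducible]
def reachabilityBraided : reachabilitySemantics.{u}.F₁.Braided where
  toMonoidal := reachabilityCoreMonoidal.toMonoidal
  braided P Q := RelSquare.hom_ext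
    (markingBraided.braided P.src Q.src) (markingBraided.braided P.tgt Q.tgt)

/-- The symmetric monoidal structure of the reachability semantics. -/
def reachabilitySymmetricMonoidal :
    SymmetricMonoidalStructure reachabilitySemantics.{u} reachabilityLax where
  braided₀ := markingBraided
  braided₁ := reachabilityBraided
  srcMap_ε := rfl
  tgtMap_ε := rfl
  srcMap_μ _ _ := rfl
  tgtMap_μ _ _ := rfl
  -- The comparisons of both double functors and of both tensor products have identity sides here.
  -- Each equation therefore compares a structure map with the same map followed by `ℕ[id]`.
  φ_tensor M₁ N₁ M₂ N₂ := RelSquare.hom_ext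
    (by ext p; exact (Multiset.map_id (Multiset.sumEquiv _ _ p)).symm)
    (by ext p; exact (Multiset.map_id (Multiset.sumEquiv _ _ p)).symm)
  φ_unit := RelSquare.hom_ext (by ext p; exact Multiset.map_id (0 : Multiset PEmpty))
    (by ext p; exact Multiset.map_id (0 : Multiset PEmpty))
  φ₀_tensor X Y := RelSquare.hom_ext
    (by ext p; exact (Multiset.map_id (Multiset.sumEquiv _ _ p)).symm)
    (by ext p; exact (Multiset.map_id (Multiset.sumEquiv _ _ p)).symm)
  φ₀_unit := rfl

theorem mainTheorem5 :
    ∃ (Φ : reachabilitySemantics.{u}.LaxStructure)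
      (M : SymmetricMonoidalStructure reachabilitySemantics.{u} Φ),
      (∀ X Y : Type u,
        (M.braided₀.toLaxMonoidal.μ X Y :
            (Multiset X × Multiset Y : Type u) ⟶ (Multiset (X ⊕ Y) : Type u)) =
          ↾fun p => p.1.map Sum.inl + p.2.map Sum.inr) ∧
      (∀ (X Y X' Y' : Type u) (P : OpenPetri X Y) (P' : OpenPetri X' Y')
        (x : Multiset X) (x' : Multiset X') (y : Multiset Y) (y' : Multiset Y'),
        (x.map Sum.inl + x'.map Sum.inr, y.map Sum.inl + y'.map Sum.inr) ∈
            (OpenPetri.tensor P P').reachability ↔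
          (x, y) ∈ P.reachability ∧ (x', y') ∈ P'.reachability) :=
  -- The structure map on objects was taken to be the forward map of `Multiset.sumEquiv`, so the
  -- required formula holds by definition.
  ⟨reachabilityLax, reachabilitySymmetricMonoidal, fun _ _ => rfl,
    fun _ _ _ _ _ _ _ _ _ _ => OpenPetri.mem_reachability_tensor_iff⟩
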